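/- Let $\mathcal H$ be a separable complex Hilbert space and let $\rho,\sigma$ be states on $\mathcal H$ (positive operators of trace $1$). Write $\log=\log_2$ with $\log 0=-\infty$ and $\log\infty=\infty$. Let $P(\rho,\tau)=\sqrt{1-F(\rho,\tau)}$ with $F(\rho,\tau)=\|\sqrt\rho\sqrt\tau\|_1^2$, and define, with values in $[-\infty,\infty]$, $$D_{\max}(\rho\|\sigma)=\inf\{\lambda\in\mathbb R:\rho\le 2^\lambda\sigma\},\qquad D_{\max}^{\epsilon}(\rho\|\sigma)=\inf\{D_{\max}(\tau\|\sigma):\tau\text{ a state},\ P(\rho,\tau)\le\epsilon\}\quad(0\le\epsilon\le1),$$ $$D_H^{\delta}(\rho\|\sigma)=-\log\inf\{\operatorname{Tr}[F\sigma]:0\le F\le \mathbb 1,\ \operatorname{Tr}[F\rho]\ge 1-\delta\}\quad(0<\delta\le 1).$$ For $\alpha>1$ a quantum $\alpha$-Rényi divergence $\mathbb D_\alpha$ is a $[-\infty,\infty]$-valued function of pairs of states, defined on all separable complex Hilbert spaces, such that $\mathbb D_\alpha(\Lambda(\rho)\|\Lambda(\sigma))\le\mathbb D_\alpha(\rho\|\sigma)$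 for every quantum channel $\Lambda$ (linear, completely positive, trace-preserving map between the trace-class operators), and such that $\mathbb D_\alpha(\rho\|\sigma)=\frac1{\alpha-1}\log\sum_i p_i^\alpha q_i^{1-\alpha}$ whenever $\rho=\sum_i p_i|e_i\rangle\langle e_i|$ and $\sigma=\sum_i q_i|e_i\rangle\langle e_i|$ for a common orthonormal basis $(e_i)$. The Petz-Rényi divergence is $D_\alpha(\rho\|\sigma)=\frac1{\alpha-1}\log\sum_{p,q}p^\alpha q^{1-\alpha}\operatorname{Tr}[E_pF_q]$, where $\rho=\sum_p p\,E_p$ and $\sigma=\sum_q q\,F_q$ are the spectral decompositions, with sums over the distinct eigenvalues including $0$. In both formulas a term with $p=0$ is $0$, and $0^{1-\alpha}=\infty$, with $\infty\cdot 0=0$. Then: 1. If $\lambda\in\mathbb R$, $\lambda\le D_{\max}(\rho\|\sigma)$ and $\epsilon=\operatorname{Tr}[(\rho-2^\lambda\sigma)_+]$, then $D_{\max}^{\sqrt\epsilon}(\rho\|\sigma)\le\lambda-\log(1-\epsilon)$. 2. For every $\epsilon\in(0,1)$, $\;D_{\max}^{\epsilon}(\rho\|\sigma)\le D_H^{1-\epsilon^2}(\rho\|\sigma)-\log(1-\epsilon^2)$.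 3. For every $\epsilon\in(0,1)$, every $\alpha>1$ and every quantum $\alpha$-Rényi divergence $\mathbb D_\alpha$, $$D_{\max}^{\epsilon}(\rho\|\sigma)\le\mathbb D_\alpha(\rho\|\sigma)+\frac{2}{\alpha-1}\log\frac1\epsilon+\log\frac1{1-\epsilon^2}.$$ 4. For every $\epsilon\in(0,1)$ and every $\alpha>1$, the inequality of part 3 also holds with the Petz-Rényi divergence $D_\alpha(\rho\|\sigma)$ in place of $\mathbb D_\alpha(\rho\|\sigma)$. -/

import Mathlib

open scoped ENNReal NNReal ComplexOrder InnerProductSpace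

universe u

noncomputable section

namespace QInfo

section Operators

variable {H : Type u} [NormedAddCommGroup H] [InnerProductSpace ℂ H] [CompleteSpace H]

variable (H) in
/-- The index set of a fixed orthonormal (Hilbert) basis of `H`. -/
def stdIndex : Set H := (exists_hilbertBasis ℂ H).choose

variable (H) in
/-- A fixed orthonormal (Hilbert) basis of `H`, used to evaluate traces. -/
def stdBasis : HilbertBasis (stdIndex H) ℂ H := (exists_hilbertBasis ℂ H).choose_spec.choose

/-- The trace of a trace-class operator (it does not depend on the basis in which it is
evaluated). -/
def trace (T : H →L[ℂ] H) : ℂ := ∑' i, ⟪stdBasis H i, T (stdBasis H i)⟫_ℂ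

/-- The trace norm `‖T‖₁ = Tr |T|`, with value `∞` if `T` is not trace class. -/
def traceNorm (T : H →L[ℂ] H) : ℝ≥0∞ :=
  ∑' i, ENNReal.ofReal (⟪stdBasis H i, (CFC.abs T) (stdBasis H i)⟫_ℂ).re

variable (H) in
/-- The set `𝒫(H)` of positive trace-class operators. -/
def posTraceClass : Set (H →L[ℂ] H) :=
  {T | 0 ≤ T ∧ Summable fun i => ⟪stdBasis H i, T (stdBasis H i)⟫_ℂ}

variable (H) in
/-- The space `ℬ₁(H)` of trace-class operators. An operator is trace class if and only if it is a
linear combination of (four) positive trace-class operators. -/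
def traceClass : Submodule ℂ (H →L[ℂ] H) := Submodule.span ℂ (posTraceClass H)

/-- Positivity of the operator on `Hⁿ` with the `n × n` matrix of blocks `A`. -/
def IsPositiveBlock {n : ℕ} (A : Fin n → Fin n → H →L[ℂ] H) : Prop :=
  ∀ x : Fin n → H, 0 ≤ ∑ i, ∑ j, ⟪x i, A i j (x j)⟫_ℂ

variable (H) in
/-- The set `𝒟(H)` of states (density operators): positive operators of trace `1`. (If the trace
series does not converge, its value is `0`, so trace `1` includes that the operator is trace
class.) -/
structure DensityOperator where
  op : H →L[ℂ] H
  nonneg : 0 ≤ op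
  trace_eq_one : trace op = 1

theorem DensityOperator.mem_traceClass (ρ : DensityOperator H) : ρ.op ∈ traceClass H := by
  refine Submodule.subset_span ⟨ρ.nonneg, ?_⟩
  by_contra h
  have h1 := ρ.trace_eq_one
  rw [trace, tsum_eq_zero_of_not_summable h] at h1
  exact zero_ne_one h1

/-- The orthogonal projection onto the eigenspace `{x | T x = p x}` (which is `0` if `p` is not an
eigenvalue). -/
def eigenProj (T : H →L[ℂ] H) (p : ℝ≥0) : H →L[ℂ] H :=
  (LinearMap.ker (T - ((p : ℝ) : ℂ) • (1 : H →L[ℂ] H)).toLinearMap).starProjection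

end Operators

section Channels

variable {H K : Type u} [NormedAddCommGroup H] [InnerProductSpace ℂ H] [CompleteSpace H]
  [NormedAddCommGroup K] [InnerProductSpace ℂ K] [CompleteSpace K]

variable (H K) in
/-- A quantum channel: a linear, completely positive, trace-preserving map between trace-class
operators. Complete positivity is positivity of all amplifications `id_n ⊗ Λ`. -/
structure QuantumChannel where
  toLinearMap : traceClass H →ₗ[ℂ] traceClass K
  completelyPositive : ∀ (n : ℕ) (T : Fin n → Fin n → traceClass H),
    IsPositiveBlock (fun i j => (T i j : H →L[ℂ] H)) →
      IsPositiveBlock (fun i j => (toLinearMap (T i j) : K →L[ℂ] K))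
  trace_preserving : ∀ T : traceClass H,
    trace (toLinearMap T : K →L[ℂ] K) = trace (T : H →L[ℂ] H)

/-- The output state `Λ(ρ)` of a quantum channel `Λ`. -/
def QuantumChannel.mapState (Λ : QuantumChannel H K) (ρ : DensityOperator H) :
    DensityOperator K where
  op := Λ.toLinearMap ⟨ρ.op, ρ.mem_traceClass⟩
  nonneg := by
    have hρ := (ContinuousLinearMap.nonneg_iff_isPositive ρ.op).1 ρ.nonneg
    have h := Λ.completelyPositive 1 (fun _ _ => ⟨ρ.op, ρ.mem_traceClass⟩) (by
      intro x
      simpa using hρ.inner_nonneg_right (x 0))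
    rw [ContinuousLinearMap.nonneg_iff_isPositive, ContinuousLinearMap.isPositive_iff_complex]
    intro x
    have hx := h (fun _ => x)
    simp only [Finset.univ_unique, Finset.sum_singleton] at hx
    have hx2 := RCLike.nonneg_iff.1 (star_nonneg_iff.2 hx)
    rw [← starRingEnd_apply, inner_conj_symm] at hx2
    refine ⟨Complex.ext (by simp) ?_, hx2.1⟩
    simpa using hx2.2.symm
  trace_eq_one := (Λ.trace_preserving ⟨ρ.op, ρ.mem_traceClass⟩).trans ρ.trace_eq_one

end Channels

/-- The logarithm to base `2` on `[0, ∞]`, with `log 0 = -∞` and `log ∞ = ∞`. -/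
def log2 (x : ℝ≥0∞) : EReal := ENNReal.log x / ((Real.log 2 : ℝ) : EReal)

section Divergences

variable {H : Type u} [NormedAddCommGroup H] [InnerProductSpace ℂ H] [CompleteSpace H]

/-- The Uhlmann fidelity `F(ρ, σ) = ‖√ρ √σ‖₁²`. -/
def fidelity (ρ σ : DensityOperator H) : ℝ≥0∞ :=
  traceNorm (CFC.sqrt ρ.op * CFC.sqrt σ.op) ^ 2

/-- The sine distance (purified distance) `P(ρ, σ) = √(1 - F(ρ, σ))`. For states, `F ≤ 1`. -/
def sineDistance (ρ σ : DensityOperator H) : ℝ≥0∞ := (1 - fidelity ρ σ) ^ (1 / 2 : ℝ)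

/-- The max-relative entropy `inf {l ∈ ℝ | ρ ≤ 2^l σ}` (which is `∞` if there is no such `l`). -/
def dMax (ρ σ : DensityOperator H) : EReal :=
  ⨅ (l : ℝ) (_ : ρ.op ≤ (((2 : ℝ) ^ l : ℝ) : ℂ) • σ.op), (l : EReal)

/-- The smoothed max-relative entropy: the infimum of `dMax τ σ` over all (normalized) states `τ`
in the sine-distance ball of radius `ε` around `ρ`. -/
def dMaxSmooth (ε : ℝ) (ρ σ : DensityOperator H) : EReal :=
  ⨅ (τ : DensityOperator H) (_ : sineDistance ρ τ ≤ ENNReal.ofReal ε), dMax τ σ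

/-- The hypothesis testing divergence
`-log inf {Tr[F σ] | 0 ≤ F ≤ 1, Tr[F ρ] ≥ 1 - δ}`. -/
def dHyp (δ : ℝ) (ρ σ : DensityOperator H) : EReal :=
  -log2 (⨅ (F : H →L[ℂ] H) (_ : 0 ≤ F ∧ F ≤ 1 ∧ 1 - δ ≤ (trace (F * ρ.op)).re),
    ENNReal.ofReal (trace (F * σ.op)).re)

/-- The operator `(ρ - 2^l σ)₊`. -/
def excess (l : ℝ) (ρ σ : DensityOperator H) : H →L[ℂ] H :=
  (ρ.op - (((2 : ℝ) ^ l : ℝ) : ℂ) • σ.op)⁺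

/-- The classical `α`-Rényi divergence `(α - 1)⁻¹ log ∑ i, p i ^ α * q i ^ (1 - α)` for `α > 1`.
The conventions of `[0, ∞]` are `0 ^ (1 - α) = ∞` and `0 * ∞ = 0`, so the value is `∞` when `p` is
not absolutely continuous with respect to `q`, and terms with `p i = 0` vanish. -/
def classicalRenyi {ι : Type u} (α : ℝ) (p q : ι → ℝ≥0) : EReal :=
  ((1 / (α - 1) : ℝ) : EReal) *
    log2 (∑' i, (p i : ℝ≥0∞) ^ α * (q i : ℝ≥0∞) ^ (1 - α))

/-- The `α`-Petz-Rényi divergence `(α - 1)⁻¹ log Tr[ρ^α σ^(1-α)]` for `α > 1`, the trace being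
`∑ p q, p ^ α * q ^ (1 - α) * Tr[E p * F q]` with `ρ = ∑ p, p • E p` and `σ = ∑ q, q • F q` the
spectral decompositions. This is the quantity `∫ t ^ α ⟨√σ| ξ(dt) |√σ⟩` for the spectral measure
`ξ` of the relative modular operator `X ↦ ρ X σ⁻¹` on Hilbert-Schmidt operators: that operator acts
as `p / q` on the range of `X ↦ E p X F q`, so that `⟨√σ| ξ |√σ⟩` has mass `q * Tr[E p * F q]` at
`p / q`. The terms with `q = 0 < p` make the value `∞` unless `supp ρ ⊆ supp σ`; the terms with
`p = 0` vanish. -/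
def petzRenyi (α : ℝ) (ρ σ : DensityOperator H) : EReal :=
  ((1 / (α - 1) : ℝ) : EReal) *
    log2 (∑' (p : ℝ≥0) (q : ℝ≥0), (p : ℝ≥0∞) ^ α * (q : ℝ≥0∞) ^ (1 - α) *
      ENNReal.ofReal (trace (eigenProj ρ.op p * eigenProj σ.op q)).re)

end Divergences

/-- An extended-real function of pairs of states, on every separable complex Hilbert space. -/
abbrev StateDivergence : Type (u + 1) :=
  ∀ (H : Type u) [NormedAddCommGroup H] [InnerProductSpace ℂ H] [CompleteSpace H]
    [TopologicalSpace.SeparableSpace H], DensityOperator H → DensityOperator H → EReal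

/-- A quantum `α`-Rényi divergence: a function of pairs of states that satisfies the
data-processing inequality and reduces to the classical `α`-Rényi divergence of the eigenvalues on
commuting states, that is, on states that are diagonal in a common orthonormal basis. -/
structure IsQuantumRenyiDivergence (α : ℝ) (D : StateDivergence.{u}) : Prop where
  data_processing : ∀ (H K : Type u)
    [NormedAddCommGroup H] [InnerProductSpace ℂ H] [CompleteSpace H]
    [TopologicalSpace.SeparableSpace H]
    [NormedAddCommGroup K] [InnerProductSpace ℂ K] [CompleteSpace K]
    [TopologicalSpace.SeparableSpace K]
    (Λ : QuantumChannel H K) (ρ σ : DensityOperator H),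
      D K (Λ.mapState ρ) (Λ.mapState σ) ≤ D H ρ σ
  classical : ∀ (H : Type u)
    [NormedAddCommGroup H] [InnerProductSpace ℂ H] [CompleteSpace H]
    [TopologicalSpace.SeparableSpace H] (ρ σ : DensityOperator H)
    (ι : Type u) (e : HilbertBasis ι ℂ H) (p q : ι → ℝ≥0),
      (∀ i, ρ.op (e i) = ((p i : ℝ) : ℂ) • e i) → (∀ i, σ.op (e i) = ((q i : ℝ) : ℂ) • e i) →
        D H ρ σ = classicalRenyi α p q

end QInfo

end

/-! Part 1. Put `A = 2^l σ`, `Δ = (ρ - 2^l σ)₊` and `B = A + Δ`, so that `ρ ≤ B`. The geometric mean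
`G` of `A` and `B⁻¹` satisfies `0 ≤ G ≤ 1` and `G B G = A` (`exists_geometric_mean`); hence `G ρ G ≤
A`. Conjugation by a contraction does not increase the trace of `B - ρ ≥ 0`, which gives `t = Tr[G ρ
G] ≥ 1 - ε` (`exists_conj_le`). The smoothing state is `τ = G ρ G / t`: it satisfies `τ ≤ 2^l σ / (1
- ε)`, and since `G² ≤ G` its fidelity with `ρ` is at least `(Tr[√ρ G √ρ])² / t ≥ t`
(`ofReal_trace_le_fidelity_conj`).

Parts 2 to 4 follow a common reduction (`dMaxSmooth_le_of_forall`): by part 1 it suffices to show `l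
≤ D` for each `l` whose excess is at least `ε²`. If `P` is the support projection of the positive
part, the excess is `p - 2^l q` with `p = Tr[P ρ]` and `q = Tr[P σ]`, so that `p ≥ ε²` and `q ≤
2^(-l) p`. For part 2, `P` is itself an admissible test. For parts 3 and 4, `p^α q^(1-α) ≥ ε²
2^(l(α-1))`, so it remains to bound this single term by the divergence.

For an abstract Rényi divergence the bound is data processing under the two-outcome measurement of
`P`. For the Petz divergence no data-processing theorem is used: the three-lines theorem is applied
to truncations of `Tr[P ρ^(1/2+z) σ^(1/2-z) P]`, between `Re z = 0` and `Re z = α/2`, and evaluated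
at `z = 1/2`. -/

noncomputable section

namespace QInfo

/-! ### Hilbert-Schmidt operators and cyclicity of the trace -/

section HilbertSchmidt

variable {H : Type u} [NormedAddCommGroup H] [InnerProductSpace ℂ H] [CompleteSpace H]

theorem inner_star_left (A : H →L[ℂ] H) (x y : H) : ⟪(star A) x, y⟫_ℂ = ⟪x, A y⟫_ℂ := by
  rw [ContinuousLinearMap.star_eq_adjoint, ContinuousLinearMap.adjoint_inner_left]

theorem inner_star_right (A : H →L[ℂ] H) (x y : H) : ⟪x, (star A) y⟫_ℂ = ⟪A x, y⟫_ℂ := by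
  rw [ContinuousLinearMap.star_eq_adjoint, ContinuousLinearMap.adjoint_inner_right]

/-- The square of the Hilbert-Schmidt norm, with value `∞` if the operator is not
Hilbert-Schmidt. -/
def hsNormSq (A : H →L[ℂ] H) : ℝ≥0∞ := ∑' i, ‖A (stdBasis H i)‖ₑ ^ 2

omit [CompleteSpace H] in
theorem hasSum_norm_inner_sq {ι : Type*} (b : HilbertBasis ι ℂ H) (x : H) :
    HasSum (fun i => ‖⟪b i, x⟫_ℂ‖ ^ 2) (‖x‖ ^ 2) := by
  have h := b.hasSum_inner_mul_inner x x
  have h2 := Complex.hasSum_re h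
  convert h2 using 1
  · funext i
    rw [← inner_conj_symm x (b i), Complex.conj_mul', ← Complex.ofReal_pow, Complex.ofReal_re]
  · rw [inner_self_eq_norm_sq_to_K]
    norm_cast

theorem ofReal_norm_sq {E : Type*} [SeminormedAddCommGroup E] (x : E) :
    ENNReal.ofReal (‖x‖ ^ 2) = ‖x‖ₑ ^ 2 := by
  rw [ENNReal.ofReal_pow (norm_nonneg _), ofReal_norm]

theorem tsum_enorm_sq_ne_top_iff {ι E : Type*} [SeminormedAddCommGroup E] {f : ι → E} :
    ∑' i, ‖f i‖ₑ ^ 2 ≠ ∞ ↔ Summable fun i => ‖f i‖ ^ 2 := by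
  simp_rw [enorm_eq_nnnorm, ← ENNReal.coe_pow, ENNReal.tsum_coe_ne_top_iff_summable,
    ← NNReal.summable_coe, NNReal.coe_pow, coe_nnnorm]

omit [CompleteSpace H] in
theorem tsum_enorm_inner_sq {ι : Type*} (b : HilbertBasis ι ℂ H) (x : H) :
    ∑' i, ‖⟪b i, x⟫_ℂ‖ₑ ^ 2 = ‖x‖ₑ ^ 2 := by
  have h := hasSum_norm_inner_sq b x
  rw [← ofReal_norm_sq, ← h.tsum_eq, ENNReal.ofReal_tsum_of_nonneg (fun _ => by positivity)
    h.summable]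
  simp only [ofReal_norm_sq]

/-- Parseval in both bases and an exchange of non-negative sums. Since the two bases are unrelated,
this yields both adjoint invariance and basis independence of the Hilbert-Schmidt norm. -/
theorem tsum_enorm_sq_eq_star {ι κ : Type*} (b : HilbertBasis ι ℂ H) (c : HilbertBasis κ ℂ H)
    (A : H →L[ℂ] H) : ∑' i, ‖A (b i)‖ₑ ^ 2 = ∑' j, ‖(star A) (c j)‖ₑ ^ 2 := by
  simp_rw [← tsum_enorm_inner_sq c (A _), ← tsum_enorm_inner_sq b ((star A) _)]
  rw [ENNReal.tsum_comm]
  refine tsum_congr fun j => tsum_congr fun i => ?_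
  rw [inner_star_right, ← inner_conj_symm, RCLike.enorm_conj]

theorem hsNormSq_star (A : H →L[ℂ] H) : hsNormSq (star A) = hsNormSq A :=
  (tsum_enorm_sq_eq_star _ _ A).symm

theorem hsNormSq_eq_tsum {ι : Type*} (b : HilbertBasis ι ℂ H) (A : H →L[ℂ] H) :
    hsNormSq A = ∑' i, ‖A (b i)‖ₑ ^ 2 := by
  rw [hsNormSq, tsum_enorm_sq_eq_star _ (stdBasis H), ← tsum_enorm_sq_eq_star b]

theorem hsNormSq_mul_le (S A : H →L[ℂ] H) : hsNormSq (S * A) ≤ ‖S‖ₑ ^ 2 * hsNormSq A := by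
  rw [hsNormSq, hsNormSq, ← ENNReal.tsum_mul_left]
  refine ENNReal.tsum_le_tsum fun i => ?_
  rw [← mul_pow]
  gcongr
  exact S.le_opENorm _

theorem hsNormSq_mul_le' (A S : H →L[ℂ] H) : hsNormSq (A * S) ≤ ‖S‖ₑ ^ 2 * hsNormSq A := by
  rw [← hsNormSq_star, star_mul, ← hsNormSq_star A]
  refine (hsNormSq_mul_le _ _).trans_eq ?_
  rw [enorm_eq_nnnorm, nnnorm_star, ← enorm_eq_nnnorm]

theorem hsNormSq_mul_le_of_norm_le_one {S : H →L[ℂ] H} (hS : ‖S‖ ≤ 1) (A : H →L[ℂ] H) :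
    hsNormSq (S * A) ≤ hsNormSq A := by
  refine (hsNormSq_mul_le S A).trans ?_
  have : ‖S‖ₑ ≤ 1 := by
    rw [← ofReal_norm]
    exact ENNReal.ofReal_le_one.2 hS
  calc _ ≤ 1 ^ 2 * hsNormSq A := by gcongr
    _ = _ := by simp

theorem hsNormSq_mul_le_of_norm_le_one' {S : H →L[ℂ] H} (hS : ‖S‖ ≤ 1) (A : H →L[ℂ] H) :
    hsNormSq (A * S) ≤ hsNormSq A := by
  rw [← hsNormSq_star, star_mul, ← hsNormSq_star A]
  exact hsNormSq_mul_le_of_norm_le_one (by rwa [norm_star]) _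

theorem hsNormSq_mul_ne_top (S : H →L[ℂ] H) {A : H →L[ℂ] H} (hA : hsNormSq A ≠ ∞) :
    hsNormSq (S * A) ≠ ∞ :=
  ne_top_of_le_ne_top (ENNReal.mul_ne_top (by simp) hA) (hsNormSq_mul_le S A)

theorem hsNormSq_mul_ne_top' (S : H →L[ℂ] H) {A : H →L[ℂ] H} (hA : hsNormSq A ≠ ∞) :
    hsNormSq (A * S) ≠ ∞ :=
  ne_top_of_le_ne_top (ENNReal.mul_ne_top (by simp) hA) (hsNormSq_mul_le' A S)

theorem summable_norm_sq_of_hsNormSq {A : H →L[ℂ] H} (hA : hsNormSq A ≠ ∞) :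
    Summable fun i => ‖A (stdBasis H i)‖ ^ 2 :=
  tsum_enorm_sq_ne_top_iff.1 hA

theorem toReal_hsNormSq (A : H →L[ℂ] H) :
    (hsNormSq A).toReal = ∑' i, ‖A (stdBasis H i)‖ ^ 2 := by
  rw [hsNormSq, ENNReal.tsum_toReal_eq (by simp)]
  simp

theorem mul_le_sq_add_sq (x y : ℝ) : x * y ≤ x ^ 2 + y ^ 2 := by
  nlinarith [sq_nonneg (x - y), sq_nonneg x, sq_nonneg y]

theorem inner_apply_star_mul (A B : H →L[ℂ] H) (x : H) :
    ⟪x, (star A * B) x⟫_ℂ = ⟪A x, B x⟫_ℂ := by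
  rw [mul_apply_eq_comp, inner_star_right]

theorem inner_apply_star_mul_self (A : H →L[ℂ] H) (x : H) :
    ⟪x, (star A * A) x⟫_ℂ = ((‖A x‖ ^ 2 : ℝ) : ℂ) := by
  rw [inner_apply_star_mul, inner_self_eq_norm_sq_to_K]
  simp

theorem trace_star_mul_self (A : H →L[ℂ] H) : trace (star A * A) = ((hsNormSq A).toReal : ℂ) := by
  rw [trace, toReal_hsNormSq, Complex.ofReal_tsum]
  simp_rw [inner_apply_star_mul_self]

theorem summable_inner_star_mul {A B : H →L[ℂ] H} (hA : hsNormSq A ≠ ∞) (hB : hsNormSq B ≠ ∞) :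
    Summable fun i => ⟪stdBasis H i, (star A * B) (stdBasis H i)⟫_ℂ := by
  refine Summable.of_norm_bounded
    ((summable_norm_sq_of_hsNormSq hA).add (summable_norm_sq_of_hsNormSq hB)) fun i => ?_
  rw [inner_apply_star_mul]
  exact (norm_inner_le_norm _ _).trans (mul_le_sq_add_sq _ _)

theorem summable_matrix_sq {A : H →L[ℂ] H} (hA : hsNormSq A ≠ ∞) :
    Summable fun ij : stdIndex H × stdIndex H =>
      ‖⟪stdBasis H ij.2, A (stdBasis H ij.1)⟫_ℂ‖ ^ 2 := by
  rw [← tsum_enorm_sq_ne_top_iff,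
    ENNReal.tsum_prod (f := fun i j => ‖⟪stdBasis H j, A (stdBasis H i)⟫_ℂ‖ₑ ^ 2)]
  simp_rw [tsum_enorm_inner_sq]
  exact hA

/-- Cyclicity of the trace for products of two Hilbert-Schmidt operators. -/
theorem trace_star_mul_comm {A B : H →L[ℂ] H} (hA : hsNormSq A ≠ ∞) (hB : hsNormSq B ≠ ∞) :
    trace (star A * B) = trace (B * star A) := by
  set e := stdBasis H
  -- Both traces are iterated sums of the same matrix products, in opposite orders; absolute
  -- summability over pairs justifies the exchange.
  have hs : Summable (Function.uncurry fun i j =>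
      ⟪A (e i), e j⟫_ℂ * ⟪e j, B (e i)⟫_ℂ) := by
    refine Summable.of_norm_bounded ((summable_matrix_sq hA).add (summable_matrix_sq hB))
      fun ij => ?_
    rw [Function.uncurry_def, norm_mul, ← inner_conj_symm (A (e ij.1)), RCLike.norm_conj]
    exact mul_le_sq_add_sq _ _
  have h1 : trace (star A * B) = ∑' i, ∑' j, ⟪A (e i), e j⟫_ℂ * ⟪e j, B (e i)⟫_ℂ := by
    refine tsum_congr fun i => ?_
    rw [inner_apply_star_mul, ← e.tsum_inner_mul_inner]
  have h2 : trace (B * star A) = ∑' j, ∑' i, ⟪A (e i), e j⟫_ℂ * ⟪e j, B (e i)⟫_ℂ := by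
    refine tsum_congr fun j => ?_
    rw [← star_star B, inner_apply_star_mul, star_star, ← e.tsum_inner_mul_inner]
    refine tsum_congr fun i => ?_
    rw [inner_star_left, inner_star_right, mul_comm]
  rw [h1, h2]
  exact hs.tsum_comm.symm

end HilbertSchmidt

/-! ### Trace-class operators -/

section TraceClass

variable {H : Type u} [NormedAddCommGroup H] [InnerProductSpace ℂ H] [CompleteSpace H]

omit [CompleteSpace H] in
theorem nonneg_iff_isPositive {T : H →L[ℂ] H} : 0 ≤ T ↔ T.IsPositive :=
  ContinuousLinearMap.nonneg_iff_isPositive T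

theorem star_sqrt (T : H →L[ℂ] H) : star (CFC.sqrt T) = CFC.sqrt T :=
  (CFC.sqrt_nonneg T).isSelfAdjoint.star_eq

theorem star_sqrt_mul_sqrt {T : H →L[ℂ] H} (hT : 0 ≤ T) : star (CFC.sqrt T) * CFC.sqrt T = T := by
  rw [star_sqrt, CFC.sqrt_mul_sqrt_self T hT]

theorem star_mul_self_mem_posTraceClass {A : H →L[ℂ] H} (hA : hsNormSq A ≠ ∞) :
    star A * A ∈ posTraceClass H :=
  ⟨star_mul_self_nonneg A, summable_inner_star_mul hA hA⟩

theorem hsNormSq_sqrt_ne_top {T : H →L[ℂ] H} (hT : T ∈ posTraceClass H) :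
    hsNormSq (CFC.sqrt T) ≠ ∞ := by
  have h := hT.2
  rw [← star_sqrt_mul_sqrt hT.1] at h
  simp_rw [inner_apply_star_mul_self] at h
  rw [Complex.summable_ofReal] at h
  exact tsum_enorm_sq_ne_top_iff.2 h

theorem summable_of_mem_traceClass {T : H →L[ℂ] H} (hT : T ∈ traceClass H) :
    Summable fun i => ⟪stdBasis H i, T (stdBasis H i)⟫_ℂ := by
  induction hT using Submodule.span_induction with
  | mem T hT => exact hT.2
  | zero => simp
  | add S T _ _ hS hT => simpa [inner_add_right] using hS.add hT
  | smul c T _ hT => simpa [inner_smul_right] using hT.mul_left c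

theorem mem_posTraceClass_of_nonneg {T : H →L[ℂ] H} (hT : T ∈ traceClass H) (h0 : 0 ≤ T) :
    T ∈ posTraceClass H :=
  ⟨h0, summable_of_mem_traceClass hT⟩

theorem posTraceClass_subset : posTraceClass H ⊆ traceClass H := Submodule.subset_span

theorem conj_mem_posTraceClass {T : H →L[ℂ] H} (hT : T ∈ posTraceClass H) (S : H →L[ℂ] H) :
    star S * T * S ∈ posTraceClass H := by
  have h := star_mul_self_mem_posTraceClass
    (hsNormSq_mul_ne_top' S (hsNormSq_sqrt_ne_top hT))
  rwa [star_mul, mul_assoc, ← mul_assoc (star (CFC.sqrt T)), star_sqrt_mul_sqrt hT.1,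
    ← mul_assoc] at h

theorem conj_mem_traceClass {T : H →L[ℂ] H} (hT : T ∈ traceClass H) (S : H →L[ℂ] H) :
    star S * T * S ∈ traceClass H := by
  induction hT using Submodule.span_induction with
  | mem T hT => exact posTraceClass_subset (conj_mem_posTraceClass hT S)
  | zero => simp
  | add T U _ _ hT hU => simpa [mul_add, add_mul] using add_mem hT hU
  | smul c T _ hT => simpa using Submodule.smul_mem _ c hT

theorem trace_add {S T : H →L[ℂ] H} (hS : S ∈ traceClass H) (hT : T ∈ traceClass H) :
    trace (S + T) = trace S + trace T := by
  simp only [trace, add_apply, inner_add_right]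
  exact (summable_of_mem_traceClass hS).tsum_add (summable_of_mem_traceClass hT)

theorem trace_sub {S T : H →L[ℂ] H} (hS : S ∈ traceClass H) (hT : T ∈ traceClass H) :
    trace (S - T) = trace S - trace T := by
  simp only [trace, sub_apply, inner_sub_right]
  exact (summable_of_mem_traceClass hS).tsum_sub (summable_of_mem_traceClass hT)

theorem trace_smul (c : ℂ) (T : H →L[ℂ] H) : trace (c • T) = c * trace T := by
  simp only [trace, smul_apply, inner_smul_right]
  exact tsum_mul_left

theorem trace_nonneg {T : H →L[ℂ] H} (hT : 0 ≤ T) : 0 ≤ trace T :=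
  tsum_nonneg fun _ => (nonneg_iff_isPositive.1 hT).inner_nonneg_right _

theorem trace_re_mono {S T : H →L[ℂ] H} (hS : S ∈ traceClass H) (hT : T ∈ traceClass H)
    (h : S ≤ T) : (trace S).re ≤ (trace T).re := by
  have := (Complex.le_def.1 (trace_nonneg (sub_nonneg.2 h))).1
  rw [trace_sub hT hS] at this
  simpa using this

theorem trace_eq_hsNormSq_sqrt {T : H →L[ℂ] H} (hT : 0 ≤ T) :
    trace T = ((hsNormSq (CFC.sqrt T)).toReal : ℂ) := by
  conv_lhs => rw [← star_sqrt_mul_sqrt hT]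
  rw [trace_star_mul_self]

theorem trace_conj {T : H →L[ℂ] H} (hT : 0 ≤ T) (S : H →L[ℂ] H) :
    trace (star S * T * S) = ((hsNormSq (CFC.sqrt T * S)).toReal : ℂ) := by
  conv_lhs => rw [← star_sqrt_mul_sqrt hT]
  rw [← trace_star_mul_self, star_mul]
  simp only [mul_assoc]

/-- Cyclicity in the form of adjoint invariance of the Hilbert-Schmidt norm of `√T S`. No
summability is needed: if that norm is infinite, both traces take the default value `0`. -/
theorem trace_conj' {T : H →L[ℂ] H} (hT : 0 ≤ T) (S : H →L[ℂ] H) :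
    trace (star S * T * S) = trace (CFC.sqrt T * (S * star S) * CFC.sqrt T) := by
  rw [trace_conj hT, ← hsNormSq_star, ← trace_star_mul_self]
  simp only [star_mul, star_star, star_sqrt, mul_assoc]

theorem trace_conj_le {T S : H →L[ℂ] H} (hT : T ∈ posTraceClass H) (hS : ‖S‖ ≤ 1) :
    (trace (star S * T * S)).re ≤ (trace T).re := by
  rw [trace_conj hT.1, trace_eq_hsNormSq_sqrt hT.1, Complex.ofReal_re, Complex.ofReal_re]
  exact ENNReal.toReal_mono (hsNormSq_sqrt_ne_top hT) (hsNormSq_mul_le_of_norm_le_one' hS _)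

theorem trace_mul_posTraceClass {T : H →L[ℂ] H} (hT : T ∈ posTraceClass H) (S : H →L[ℂ] H) :
    trace (S * T) = trace (CFC.sqrt T * S * CFC.sqrt T) := by
  have h1 := hsNormSq_sqrt_ne_top hT
  have h2 := hsNormSq_mul_ne_top S h1
  have h := trace_star_mul_comm h1 h2
  rw [star_sqrt] at h
  rw [mul_assoc, h, mul_assoc, CFC.sqrt_mul_sqrt_self T hT.1]

theorem trace_proj_mul {T P : H →L[ℂ] H} (hT : T ∈ posTraceClass H) (hP : IsStarProjection P) :
    trace (P * T) = trace (P * T * P) := by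
  have h := trace_conj' hT.1 P
  rw [hP.isSelfAdjoint.star_eq, hP.isIdempotentElem.eq] at h
  rw [h, trace_mul_posTraceClass hT]

/-- For `T ≥ 0` cyclicity turns the two terms into `Tr[√T P √T]` and `Tr[√T (1 - P) √T]`, which add
up to `Tr T`; linearity covers the span. This makes the measurement channel trace preserving. -/
theorem trace_proj_add_trace_compl {T P : H →L[ℂ] H} (hT : T ∈ traceClass H)
    (hP : IsStarProjection P) :
    trace (P * T * P) + trace ((1 - P) * T * (1 - P)) = trace T := by
  have hs := hP.isSelfAdjoint.star_eq
  have hs' := hP.one_sub.isSelfAdjoint.star_eq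
  have hm : ∀ T ∈ traceClass H, P * T * P ∈ traceClass H := fun T hT => by
    simpa [hs] using conj_mem_traceClass hT P
  have hm' : ∀ T ∈ traceClass H, (1 - P) * T * (1 - P) ∈ traceClass H := fun T hT => by
    simpa [hs] using conj_mem_traceClass hT (1 - P)
  induction hT using Submodule.span_induction with
  | mem T hT =>
    have h1 := trace_conj' hT.1 P
    have h2 := trace_conj' hT.1 (1 - P)
    rw [hs, hP.isIdempotentElem.eq] at h1
    rw [hs', hP.one_sub.isIdempotentElem.eq] at h2
    rw [h1, h2, ← trace_add]
    · rw [← add_mul, ← mul_add, add_sub_cancel, mul_one, CFC.sqrt_mul_sqrt_self T hT.1]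
    · have := star_mul_self_mem_posTraceClass
        (hsNormSq_mul_ne_top P (hsNormSq_sqrt_ne_top hT))
      rw [star_mul, star_sqrt, hs, mul_assoc, ← mul_assoc P, hP.isIdempotentElem.eq,
        ← mul_assoc] at this
      exact posTraceClass_subset this
    · have := star_mul_self_mem_posTraceClass
        (hsNormSq_mul_ne_top (1 - P) (hsNormSq_sqrt_ne_top hT))
      rw [star_mul, star_sqrt, hs', mul_assoc, ← mul_assoc (1 - P),
        hP.one_sub.isIdempotentElem.eq, ← mul_assoc] at this
      exact posTraceClass_subset this
  | zero => simp [trace]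
  | add T U hT' hU' hT hU =>
    rw [trace_add hT' hU', ← hT, ← hU, mul_add, add_mul, mul_add, add_mul,
      trace_add (hm _ hT') (hm _ hU'), trace_add (hm' _ hT') (hm' _ hU')]
    ring
  | smul c T _ hT =>
    rw [trace_smul, ← hT, mul_smul_comm, smul_mul_assoc, mul_smul_comm, smul_mul_assoc,
      trace_smul, trace_smul, mul_add]

theorem DensityOperator.mem_posTraceClass (ρ : DensityOperator H) : ρ.op ∈ posTraceClass H :=
  mem_posTraceClass_of_nonneg ρ.mem_traceClass ρ.nonneg

end TraceClass

/-! ### Operator factorizations: contractions, geometric means, positive parts -/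

section Factorization

variable {H : Type u} [NormedAddCommGroup H] [InnerProductSpace ℂ H] [CompleteSpace H]

/-- Douglas' factorization lemma for contractions. -/
theorem exists_contraction_factor {A B : H →L[ℂ] H} (h : ∀ x, ‖A x‖ ≤ ‖B x‖) :
    ∃ C : H →L[ℂ] H, ‖C‖ ≤ 1 ∧ A = C * B ∧ ∀ x, (star B) x = 0 → C x = 0 := by
  set U : Submodule ℂ H := B.toLinearMap.range.topologicalClosure with hU
  have hmem : ∀ x, B x ∈ U := fun x =>
    Submodule.le_topologicalClosure _ (LinearMap.mem_range_self B.toLinearMap x)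
  have : CompleteSpace U := (Submodule.isClosed_topologicalClosure _).completeSpace_coe
  let e : H →ₗ[ℂ] U := B.toLinearMap.codRestrict U hmem
  have hd : DenseRange e := by
    intro y
    have hy : (y : H) ∈ closure (Set.range B) := by
      exact y.2
    rw [closure_subtype]
    convert hy using 2
    ext z
    constructor
    · rintro ⟨_, ⟨x, rfl⟩, rfl⟩
      exact ⟨x, rfl⟩
    · rintro ⟨x, rfl⟩
      exact ⟨e x, ⟨x, rfl⟩, rfl⟩
  have hn : ∀ x, ‖A.toLinearMap x‖ ≤ 1 * ‖e x‖ := fun x => by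
    rw [one_mul]
    exact h x
  let D : U →L[ℂ] H := A.toLinearMap.extendOfNorm e
  have hD : ‖D‖ ≤ 1 := LinearMap.opNorm_extendOfNorm_le hd zero_le_one hn
  -- Extending by `0` off the closed range of `B` makes the factor vanish on the kernel of `star B`.
  refine ⟨D ∘L U.orthogonalProjectionOnto, ?_, ?_, ?_⟩
  · refine (ContinuousLinearMap.opNorm_comp_le _ _).trans ?_
    exact mul_le_one₀ hD (norm_nonneg _) (Submodule.orthogonalProjectionOnto_norm_le U)
  · ext x
    have h1 : U.orthogonalProjectionOnto (B x) = e x :=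
      Submodule.orthogonalProjectionOnto_mem_subspace_eq_self (e x)
    have h2 : D (e x) = A x := LinearMap.extendOfNorm_eq hd ⟨1, hn⟩ x
    simp [h1, h2]
  · intro x hx
    have h1 : U.orthogonalProjectionOnto x = 0 := by
      rw [Submodule.orthogonalProjectionOnto_eq_zero_iff, hU, Submodule.orthogonal_closure,
        Submodule.mem_orthogonal]
      rintro _ ⟨y, rfl⟩
      have := inner_star_right B y x
      rw [hx, inner_zero_right] at this
      exact this.symm
    simp [h1]

theorem norm_sqrt_apply_sq {T : H →L[ℂ] H} (hT : 0 ≤ T) (x : H) :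
    ((‖CFC.sqrt T x‖ ^ 2 : ℝ) : ℂ) = ⟪x, T x⟫_ℂ := by
  conv_rhs => rw [← star_sqrt_mul_sqrt hT]
  rw [inner_apply_star_mul_self]

theorem norm_sqrt_apply_le {S T : H →L[ℂ] H} (hS : 0 ≤ S) (hST : S ≤ T) (x : H) :
    ‖CFC.sqrt S x‖ ≤ ‖CFC.sqrt T x‖ := by
  have h := (nonneg_iff_isPositive.1 (sub_nonneg.2 hST)).inner_nonneg_right x
  rw [sub_apply, inner_sub_right, sub_nonneg, ← norm_sqrt_apply_sq hS,
    ← norm_sqrt_apply_sq (hS.trans hST), Complex.real_le_real] at h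
  exact (sq_le_sq₀ (norm_nonneg _) (norm_nonneg _)).1 h

theorem norm_apply_eq_of_star_mul_self_eq {S T : H →L[ℂ] H} (h : star S * S = star T * T) (x : H) :
    ‖S x‖ = ‖T x‖ := by
  have h1 := inner_apply_star_mul_self S x
  rw [h, inner_apply_star_mul_self T x] at h1
  exact (pow_left_inj₀ (norm_nonneg _) (norm_nonneg _) two_ne_zero).1 (by exact_mod_cast h1.symm)

theorem apply_eq_zero_of_self_apply {N : H →L[ℂ] H} (hN : IsSelfAdjoint N) {x : H}
    (h : N (N x) = 0) : N x = 0 := by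
  have h1 := inner_star_right N x (N x)
  rw [hN.star_eq, h, inner_zero_right] at h1
  exact inner_self_eq_zero.1 h1.symm

theorem star_mul_self_le_one {C : H →L[ℂ] H} (hC : ‖C‖ ≤ 1) : star C * C ≤ 1 := by
  have h := CStarAlgebra.star_mul_le_algebraMap_norm_sq (a := C)
  refine h.trans ?_
  have h2 : ‖C‖ ^ 2 ≤ 1 := pow_le_one₀ (norm_nonneg _) hC
  have := algebraMap_mono (H →L[ℂ] H) h2
  simpa using this

/-- For `0 ≤ A ≤ B` there is a solution `0 ≤ G ≤ 1` of `G B G = A`, namely the geometric mean of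
`A` and the inverse of `B`. -/
theorem exists_geometric_mean {A B : H →L[ℂ] H} (hA : 0 ≤ A) (hAB : A ≤ B) :
    ∃ G : H →L[ℂ] H, 0 ≤ G ∧ G ≤ 1 ∧ G * B * G = A := by
  have hB : 0 ≤ B := hA.trans hAB
  set R := CFC.sqrt B with hR
  have hRs : star R = R := star_sqrt B
  have hRR : R * R = B := CFC.sqrt_mul_sqrt_self B hB
  have hX0 : 0 ≤ R * A * R := by simpa [hRs] using star_left_conjugate_nonneg hA R
  have hXB : R * A * R ≤ B * B := by
    have := star_left_conjugate_le_conjugate hAB R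
    rw [hRs] at this
    refine this.trans_eq ?_
    simp only [← hRR, mul_assoc]
  -- Formally `G = B^(-1/2) (B^(1/2) A B^(1/2))^(1/2) B^(-1/2)`. As `B` need not be invertible,
  -- operator monotonicity of the square root gives `M ≤ B`, and factoring `√M = C R` replaces the
  -- two inverses: `G = C* C`.
  set M := CFC.sqrt (R * A * R) with hM
  have hMB : M ≤ B := by
    have := CFC.sqrt_le_sqrt _ _ hXB
    rwa [CFC.sqrt_mul_self B hB] at this
  have hM0 : 0 ≤ M := CFC.sqrt_nonneg _
  have hMM : M * M = R * A * R := CFC.sqrt_mul_sqrt_self _ hX0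
  obtain ⟨C, hC1, hC, hCk⟩ := exists_contraction_factor (norm_sqrt_apply_le hM0 hMB)
  rw [← hR] at hC hCk
  rw [hRs] at hCk
  set G := star C * C with hG
  have hGs : star G = G := by simp [hG]
  have hMG : M = R * G * R := by
    rw [← star_sqrt_mul_sqrt hM0, hC, star_mul, hRs]
    simp only [hG, mul_assoc]
  refine ⟨G, star_mul_self_nonneg C, star_mul_self_le_one hC1, ?_⟩
  -- Squaring `M = R G R` only gives `R N R = 0`. Because `N` is self-adjoint and vanishes on `ker
  -- R`, each factor `R` can be cancelled in turn.
  set N := G * B * G - A with hN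
  have hNs : IsSelfAdjoint N := by
    clear_value G
    rw [IsSelfAdjoint, hN, star_sub, star_mul, star_mul, hGs, hB.isSelfAdjoint.star_eq,
      hA.isSelfAdjoint.star_eq, mul_assoc]
  have hRN : R * (N * R) = 0 := by
    have : R * (G * B * G) * R = R * A * R := by
      rw [← hMM, hMG, ← hRR]
      simp only [mul_assoc]
    rw [← mul_assoc, hN, mul_sub, sub_mul, this, sub_self]
  have hker : ∀ x, R x = 0 → N x = 0 := by
    intro x hx
    have h1 : A x = 0 := by
      have h2 := norm_sqrt_apply_le hA hAB x
      rw [← hR, hx, norm_zero] at h2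
      rw [← CFC.sqrt_mul_sqrt_self A hA, mul_apply_eq_comp, norm_le_zero_iff.1 h2, map_zero]
    have h3 : G x = 0 := by rw [hG, mul_apply_eq_comp, hCk x hx, map_zero]
    simp [hN, h1, h3]
  have hNR : N * R = 0 := by
    ext x
    exact apply_eq_zero_of_self_apply hNs (hker _ (by simpa using congr($hRN x)))
  have hRN' : R * N = 0 := by
    have := congr(star $hNR)
    rwa [star_mul, hRs, hNs.star_eq, star_zero] at this
  have : N = 0 := by
    ext x
    exact apply_eq_zero_of_self_apply hNs (hker _ (by simpa using congr($hRN' x)))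
  exact sub_eq_zero.1 this

/-- The support projection of the positive part of a self-adjoint operator. -/
theorem exists_proj_conj_eq_posPart {X : H →L[ℂ] H} (hX : IsSelfAdjoint X) :
    ∃ P : H →L[ℂ] H, IsStarProjection P ∧ P * X * P = X⁺ := by
  -- The projection sought is the complement of the one onto `ker X⁺`. It fixes `X⁺`, and kills `X⁻`
  -- because `X⁺ X⁻ = 0`.
  set U : Submodule ℂ H := LinearMap.ker (X⁺).toLinearMap with hU
  have : CompleteSpace U := (X⁺).isClosed_ker.completeSpace_coe
  have hQ : IsStarProjection U.starProjection := isStarProjection_starProjection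
  set Q := U.starProjection
  have h1 : X⁺ * Q = 0 := by
    ext x
    have : Q x ∈ U := Submodule.starProjection_apply_mem U x
    simpa [hU] using this
  have h2 : Q * X⁻ = X⁻ := by
    ext x
    refine Submodule.starProjection_eq_self_iff.2 ?_
    exact congr($(CFC.posPart_mul_negPart X) x)
  have h3 : X⁺ * (1 - Q) = X⁺ := by rw [mul_sub, h1, mul_one, sub_zero]
  have h4 : (1 - Q) * X⁺ = X⁺ := by
    have := congr(star $h3)
    rwa [star_mul, hQ.one_sub.isSelfAdjoint.star_eq,
      (CFC.posPart_nonneg X).isSelfAdjoint.star_eq] at this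
  refine ⟨1 - Q, hQ.one_sub, ?_⟩
  have h5 : (1 - Q) * X = X⁺ := by
    conv_lhs => rw [← CFC.posPart_sub_negPart X hX]
    rw [mul_sub, h4, sub_mul 1 Q, one_mul, h2, sub_self, sub_zero]
  rw [h5, h3]

end Factorization

/-! ### Trace norm and fidelity -/

section Fidelity

variable {H : Type u} [NormedAddCommGroup H] [InnerProductSpace ℂ H] [CompleteSpace H]

theorem traceNorm_eq_hsNormSq (T : H →L[ℂ] H) : traceNorm T = hsNormSq (CFC.sqrt (CFC.abs T)) := by
  refine tsum_congr fun i => ?_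
  rw [← norm_sqrt_apply_sq (CFC.abs_nonneg T), Complex.ofReal_re, ofReal_norm_sq]

/-- With `T = W |T|` and `S = |T|^(1/2)`, the trace of `T V` is the Hilbert-Schmidt pairing of `S
W*` and `S V`. Both have squared norm at most `Tr |T|`, so the arithmetic-geometric mean inequality
suffices. -/
theorem ofReal_trace_mul_le_traceNorm (T : H →L[ℂ] H) {V : H →L[ℂ] H} (hV : ‖V‖ ≤ 1) :
    ENNReal.ofReal (trace (T * V)).re ≤ traceNorm T := by
  rw [traceNorm_eq_hsNormSq]
  set S := CFC.sqrt (CFC.abs T) with hS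
  by_cases hfin : hsNormSq S = ∞
  · simp [hfin]
  have habs : star (CFC.abs T) = CFC.abs T := (CFC.abs_nonneg T).isSelfAdjoint.star_eq
  obtain ⟨W, hW, hTW, -⟩ := exists_contraction_factor (A := T) (B := CFC.abs T) fun x =>
    (norm_apply_eq_of_star_mul_self_eq (by rw [habs, CFC.abs_mul_abs]) x).le
  have hSs : star S = S := star_sqrt _
  have hT : T * V = star (S * star W) * (S * V) := by
    rw [star_mul, star_star, hSs]
    conv_lhs => rw [hTW, ← CFC.sqrt_mul_sqrt_self (CFC.abs T) (CFC.abs_nonneg T)]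
    simp only [hS, mul_assoc]
  have hW' := hsNormSq_mul_le_of_norm_le_one' (S := star W) (by rwa [norm_star]) S
  have hV' := hsNormSq_mul_le_of_norm_le_one' hV S
  have hfW := ne_top_of_le_ne_top hfin hW'
  have hfV := ne_top_of_le_ne_top hfin hV'
  have h1 := ENNReal.toReal_mono hfin hW'
  have h2 := ENNReal.toReal_mono hfin hV'
  refine ENNReal.ofReal_le_of_le_toReal ?_
  have h3 : (trace (T * V)).re ≤
      ((hsNormSq (S * star W)).toReal + (hsNormSq (S * V)).toReal) / 2 := by
    rw [hT, trace, Complex.re_tsum (summable_inner_star_mul hfW hfV), toReal_hsNormSq,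
      toReal_hsNormSq, ← (summable_norm_sq_of_hsNormSq hfW).tsum_add
        (summable_norm_sq_of_hsNormSq hfV), ← tsum_div_const]
    refine Summable.tsum_le_tsum (fun i => ?_)
      (Complex.hasSum_re (summable_inner_star_mul hfW hfV).hasSum).summable
      (((summable_norm_sq_of_hsNormSq hfW).add (summable_norm_sq_of_hsNormSq hfV)).div_const 2)
    rw [inner_apply_star_mul]
    have h4 := (Complex.re_le_norm _).trans (norm_inner_le_norm (𝕜 := ℂ)
      ((S * star W) (stdBasis H i)) ((S * V) (stdBasis H i)))
    nlinarith [sq_nonneg (‖(S * star W) (stdBasis H i)‖ - ‖(S * V) (stdBasis H i)‖)]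
  linarith

/-- The easy half of Uhlmann's theorem: polar decomposition writes any `K` with `K K* = T` as `√T`
times a contraction. It bounds the fidelity from below without computing the square root of `G ρ G`.
-/
theorem ofReal_trace_le_traceNorm_sqrt {T K : H →L[ℂ] H} (S : H →L[ℂ] H) (hT : T = K * star K) :
    ENNReal.ofReal (trace (S * K)).re ≤ traceNorm (S * CFC.sqrt T) := by
  have h0 : 0 ≤ T := hT ▸ mul_star_self_nonneg K
  obtain ⟨V, hV, hKV, -⟩ := exists_contraction_factor (A := star K) (B := CFC.sqrt T) fun x =>
    (norm_apply_eq_of_star_mul_self_eq (by rw [star_star, star_sqrt_mul_sqrt h0, hT]) x).le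
  have hK : K = CFC.sqrt T * star V := by
    rw [← star_star K, hKV, star_mul, star_sqrt]
  conv_lhs => rw [hK]
  rw [← mul_assoc]
  exact ofReal_trace_mul_le_traceNorm _ (by rwa [norm_star])

/-- Expand `√G (1 - G) √G ≥ 0`. -/
theorem sq_le_self_of_le_one {G : H →L[ℂ] H} (h0 : 0 ≤ G) (h1 : G ≤ 1) : G * G ≤ G := by
  have h := star_left_conjugate_nonneg (sub_nonneg.2 h1) (CFC.sqrt G)
  have hs := CFC.sqrt_mul_sqrt_self G h0
  rw [star_sqrt, mul_sub, sub_mul, mul_one, hs, sub_nonneg] at h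
  refine le_trans (le_of_eq ?_) h
  conv_lhs => rw [← hs]
  conv_rhs => enter [1, 2]; rw [← hs]
  simp only [mul_assoc]

theorem sqrt_conj_mem_posTraceClass {T S : H →L[ℂ] H} (hT : T ∈ posTraceClass H) (hS : 0 ≤ S) :
    CFC.sqrt T * S * CFC.sqrt T ∈ posTraceClass H := by
  have h := star_mul_self_mem_posTraceClass
    (hsNormSq_mul_ne_top (CFC.sqrt S) (hsNormSq_sqrt_ne_top hT))
  rwa [star_mul, star_sqrt, mul_assoc, ← mul_assoc (star (CFC.sqrt S)), star_sqrt_mul_sqrt hS,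
    ← mul_assoc] at h

/-- The normalization of a positive trace-class operator. -/
def DensityOperator.ofPos {T : H →L[ℂ] H} (hT : 0 ≤ T) (ht : (trace T).re ≠ 0) :
    DensityOperator H where
  op := (((trace T).re⁻¹ : ℝ) : ℂ) • T
  nonneg := by
    refine smul_nonneg ?_ hT
    rw [Complex.zero_le_real, inv_nonneg]
    exact (Complex.le_def.1 (trace_nonneg hT)).1
  trace_eq_one := by
    rw [trace_smul]
    have h := (Complex.le_def.1 (trace_nonneg hT)).2
    have h2 : trace T = (((trace T).re : ℝ) : ℂ) := Complex.ext (by simp) (by simpa using h.symm)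
    conv_lhs => rw [h2]
    rw [Complex.ofReal_re, ← Complex.ofReal_mul, inv_mul_cancel₀ ht, Complex.ofReal_one]

/-- A tight gentle measurement lemma: conjugation of a state by `0 ≤ G ≤ 1`, followed by
normalization, yields a state of fidelity at least `Tr[G ρ G]`. -/
theorem ofReal_trace_le_fidelity_conj (ρ : DensityOperator H) {G : H →L[ℂ] H} (h0 : 0 ≤ G)
    (h1 : G ≤ 1) (hG : 0 ≤ G * ρ.op * G) (ht : (trace (G * ρ.op * G)).re ≠ 0) :
    ENNReal.ofReal (trace (G * ρ.op * G)).re ≤ fidelity ρ (DensityOperator.ofPos hG ht) := by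
  set t := (trace (G * ρ.op * G)).re with htdef
  have hGs : star G = G := h0.isSelfAdjoint.star_eq
  have ht0 : 0 < t := lt_of_le_of_ne (Complex.le_def.1 (trace_nonneg hG)).1 (Ne.symm ht)
  set R := CFC.sqrt ρ.op with hR
  have hRs : star R = R := star_sqrt _
  have hRR : R * R = ρ.op := CFC.sqrt_mul_sqrt_self _ ρ.nonneg
  -- `K = G √ρ / √t` satisfies `K K* = τ`, and `Tr[√ρ K] = Tr[√ρ G √ρ] / √t ≥ Tr[√ρ G² √ρ] / √t =
  -- √t`.
  set K : H →L[ℂ] H := (((Real.sqrt t)⁻¹ : ℝ) : ℂ) • (G * R) with hK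
  have hτ : (DensityOperator.ofPos hG ht).op = K * star K := by
    rw [hK, star_smul, star_mul, hRs, hGs, smul_mul_smul_comm]
    change (((t : ℝ)⁻¹ : ℝ) : ℂ) • _ = _
    congr 1
    · rw [Complex.star_def, Complex.conj_ofReal, ← Complex.ofReal_mul, ← mul_inv,
        Real.mul_self_sqrt ht0.le]
    · rw [← hRR]
      simp only [mul_assoc]
  have h := ofReal_trace_le_traceNorm_sqrt R hτ
  have h2 : Real.sqrt t ≤ (trace (R * K)).re := by
    have h3 : t ≤ (trace (R * G * R)).re := by
      rw [htdef]
      have := trace_conj' ρ.nonneg G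
      rw [hGs] at this
      rw [this]
      refine trace_re_mono ?_ ?_ ?_
      · refine posTraceClass_subset (sqrt_conj_mem_posTraceClass ρ.mem_posTraceClass ?_)
        simpa [hGs] using star_mul_self_nonneg G
      · exact posTraceClass_subset (sqrt_conj_mem_posTraceClass ρ.mem_posTraceClass h0)
      · simpa [hRs] using star_left_conjugate_le_conjugate (sq_le_self_of_le_one h0 h1) R
    rw [hK, mul_smul_comm, trace_smul, Complex.re_ofReal_mul, ← mul_assoc]
    calc Real.sqrt t = (Real.sqrt t)⁻¹ * t := by
          rw [inv_mul_eq_div, Real.div_sqrt]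
      _ ≤ _ := by gcongr
  calc ENNReal.ofReal t = ENNReal.ofReal (Real.sqrt t) ^ 2 := by
        rw [← ENNReal.ofReal_pow (Real.sqrt_nonneg _), Real.sq_sqrt ht0.le]
    _ ≤ ENNReal.ofReal (trace (R * K)).re ^ 2 := by gcongr
    _ ≤ _ := by
        rw [fidelity]
        gcongr

end Fidelity

/-! ### The logarithm on `[0, ∞]` -/

section Log

theorem log2_mono {x y : ℝ≥0∞} (h : x ≤ y) : log2 x ≤ log2 y := by
  refine EReal.div_le_div_right_of_nonneg ?_ (ENNReal.log_monotone h)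
  exact_mod_cast (Real.log_pos one_lt_two).le

theorem log2_ofReal {x : ℝ} (hx : 0 < x) : log2 (ENNReal.ofReal x) = (Real.logb 2 x : ℝ) := by
  rw [log2, ENNReal.log_ofReal_of_pos hx, ← EReal.coe_div, Real.logb]

theorem log2_zero : log2 0 = ⊥ := by
  rw [log2, ENNReal.log_zero]
  exact EReal.bot_div_of_pos_ne_top (by exact_mod_cast Real.log_pos one_lt_two)
    (EReal.coe_ne_top _)

end Log

/-! ### The smoothing construction and its reduction to projective tests -/

section Smoothing

variable {H : Type u} [NormedAddCommGroup H] [InnerProductSpace ℂ H] [CompleteSpace H]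

theorem trace_re_nonneg {T : H →L[ℂ] H} (hT : 0 ≤ T) : 0 ≤ (trace T).re :=
  (Complex.le_def.1 (trace_nonneg hT)).1

theorem conj_proj_nonneg {T P : H →L[ℂ] H} (hT : 0 ≤ T) (hP : IsStarProjection P) :
    0 ≤ P * T * P := by
  simpa [hP.isSelfAdjoint.star_eq] using star_left_conjugate_nonneg hT P

theorem conj_proj_mem_traceClass {T P : H →L[ℂ] H} (hT : T ∈ traceClass H)
    (hP : IsStarProjection P) : P * T * P ∈ traceClass H := by
  simpa [hP.isSelfAdjoint.star_eq] using conj_mem_traceClass hT P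

theorem two_rpow_smul_nonneg {T : H →L[ℂ] H} (l : ℝ) (hT : 0 ≤ T) :
    0 ≤ (((2 : ℝ) ^ l : ℝ) : ℂ) • T :=
  smul_nonneg (Complex.zero_le_real.2 (by positivity)) hT

theorem smul_mono_of_le {T : H →L[ℂ] H} (hT : 0 ≤ T) {a b : ℝ} (h : a ≤ b) :
    (a : ℂ) • T ≤ (b : ℂ) • T :=
  smul_le_smul_of_nonneg_right (Complex.real_le_real.2 h) hT

theorem isSelfAdjoint_sub_smul (l : ℝ) (ρ σ : DensityOperator H) :
    IsSelfAdjoint (ρ.op - (((2 : ℝ) ^ l : ℝ) : ℂ) • σ.op) :=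
  ρ.nonneg.isSelfAdjoint.sub (two_rpow_smul_nonneg l σ.nonneg).isSelfAdjoint

theorem exists_proj_excess (l : ℝ) (ρ σ : DensityOperator H) :
    ∃ P : H →L[ℂ] H, IsStarProjection P ∧
      excess l ρ σ = P * ρ.op * P - (((2 : ℝ) ^ l : ℝ) : ℂ) • (P * σ.op * P) := by
  obtain ⟨P, hP, h⟩ := exists_proj_conj_eq_posPart (isSelfAdjoint_sub_smul l ρ σ)
  refine ⟨P, hP, ?_⟩
  rw [excess, ← h, mul_sub, sub_mul, mul_smul_comm, smul_mul_assoc]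

/-- A positive part carries no summability by itself; the compressed form `P (ρ - 2^l σ) P` shows
that it is trace class. -/
theorem excess_mem_posTraceClass (l : ℝ) (ρ σ : DensityOperator H) :
    excess l ρ σ ∈ posTraceClass H := by
  refine mem_posTraceClass_of_nonneg ?_ (CFC.posPart_nonneg _)
  obtain ⟨P, hP, h⟩ := exists_proj_excess l ρ σ
  rw [h]
  exact sub_mem (conj_proj_mem_traceClass ρ.mem_traceClass hP)
    (Submodule.smul_mem _ _ (conj_proj_mem_traceClass σ.mem_traceClass hP))

theorem exists_proj_trace_excess (l : ℝ) (ρ σ : DensityOperator H) :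
    ∃ P : H →L[ℂ] H, IsStarProjection P ∧ (trace (excess l ρ σ)).re =
      (trace (P * ρ.op * P)).re - (2 : ℝ) ^ l * (trace (P * σ.op * P)).re := by
  obtain ⟨P, hP, h⟩ := exists_proj_excess l ρ σ
  refine ⟨P, hP, ?_⟩
  rw [h, trace_sub (conj_proj_mem_traceClass ρ.mem_traceClass hP)
    (Submodule.smul_mem _ _ (conj_proj_mem_traceClass σ.mem_traceClass hP)), trace_smul,
    Complex.sub_re, Complex.re_ofReal_mul]

/-- If `ρ ≤ A + Δ` for positive trace-class operators `A` and `Δ`, then some `0 ≤ G ≤ 1` satisfies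
`G ρ G ≤ A` and `Tr[G ρ G] ≥ Tr ρ - Tr Δ`. -/
theorem exists_conj_le {A Δ R : H →L[ℂ] H} (hA : A ∈ posTraceClass H) (hΔ : Δ ∈ posTraceClass H)
    (hR : R ∈ posTraceClass H) (h : R ≤ A + Δ) :
    ∃ G : H →L[ℂ] H, 0 ≤ G ∧ G ≤ 1 ∧ G * R * G ≤ A ∧
      (trace R).re - (trace Δ).re ≤ (trace (G * R * G)).re := by
  obtain ⟨G, hG0, hG1, hG⟩ := exists_geometric_mean hA.1 (le_add_of_nonneg_right hΔ.1 : A ≤ A + Δ)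
  have hGs : star G = G := hG0.isSelfAdjoint.star_eq
  have hconj : ∀ T ∈ traceClass H, G * T * G ∈ traceClass H := fun T hT => by
    simpa [hGs] using conj_mem_traceClass hT G
  have hA' := posTraceClass_subset hA
  have hΔ' := posTraceClass_subset hΔ
  have hR' := posTraceClass_subset hR
  have hB := add_mem hA' hΔ'
  refine ⟨G, hG0, hG1, ?_, ?_⟩
  · have := star_left_conjugate_le_conjugate h G
    rwa [hGs, hG] at this
  · have hnorm : ‖G‖ ≤ 1 := (CStarAlgebra.norm_le_one_iff_of_nonneg G hG0).2 hG1
    -- The contraction bound is applied to `B - R ≥ 0` with `B = A + Δ`: from `Tr A - Tr[G R G] ≤ Tr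
    -- A + Tr Δ - Tr R` the term `Tr A` cancels.
    have h1 := trace_conj_le (mem_posTraceClass_of_nonneg (sub_mem hB hR') (sub_nonneg.2 h)) hnorm
    rw [hGs, mul_sub, sub_mul, hG, trace_sub hA' (hconj _ hR'), trace_sub hB hR',
      trace_add hA' hΔ'] at h1
    simp only [Complex.sub_re, Complex.add_re] at h1
    linarith

theorem dMaxSmooth_le_of_excess_lt_one {l ε : ℝ} (ρ σ : DensityOperator H)
    (hε : ε = (trace (excess l ρ σ)).re) (h1 : ε < 1) :
    dMaxSmooth (Real.sqrt ε) ρ σ ≤ ((l - Real.logb 2 (1 - ε) : ℝ) : EReal) := by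
  have hex := excess_mem_posTraceClass l ρ σ
  have hA0 := two_rpow_smul_nonneg l σ.nonneg
  have hA := mem_posTraceClass_of_nonneg
    (Submodule.smul_mem _ (((2 : ℝ) ^ l : ℝ) : ℂ) σ.mem_traceClass) hA0
  have hρ : ρ.op ≤ (((2 : ℝ) ^ l : ℝ) : ℂ) • σ.op + excess l ρ σ := by
    rw [← sub_le_iff_le_add']
    exact CFC.le_posPart (isSelfAdjoint_sub_smul l ρ σ)
  obtain ⟨G, hG0, hG1, hGA, hGt⟩ := exists_conj_le hA hex ρ.mem_posTraceClass hρ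
  rw [ρ.trace_eq_one, Complex.one_re, ← hε] at hGt
  have hGR : 0 ≤ G * ρ.op * G := by
    simpa [hG0.isSelfAdjoint.star_eq] using star_left_conjugate_nonneg ρ.nonneg G
  have hε0 : 0 ≤ ε := hε ▸ trace_re_nonneg hex.1
  have ht0 : 0 < (trace (G * ρ.op * G)).re := by linarith
  have hF := ofReal_trace_le_fidelity_conj ρ hG0 hG1 hGR ht0.ne'
  set τ := DensityOperator.ofPos hGR ht0.ne'
  refine (iInf₂_le τ ?_).trans (iInf₂_le _ ?_)
  · have h2 : 1 - fidelity ρ τ ≤ ENNReal.ofReal ε := by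
      rw [tsub_le_iff_right]
      calc (1 : ℝ≥0∞) = ENNReal.ofReal ε + ENNReal.ofReal (1 - ε) := by
            rw [← ENNReal.ofReal_add hε0 (by linarith)]
            simp
        _ ≤ _ := by
            gcongr
            exact (ENNReal.ofReal_le_ofReal hGt).trans hF
    rw [sineDistance, Real.sqrt_eq_rpow, ← ENNReal.ofReal_rpow_of_nonneg hε0 (by norm_num)]
    gcongr
  · have hpow : (2 : ℝ) ^ (l - Real.logb 2 (1 - ε)) = (1 - ε)⁻¹ * 2 ^ l := by
      rw [Real.rpow_sub two_pos, Real.rpow_logb two_pos (by norm_num) (by linarith)]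
      field_simp
    change (((trace (G * ρ.op * G)).re⁻¹ : ℝ) : ℂ) • (G * ρ.op * G) ≤ _
    refine (smul_mono_of_le hGR (inv_anti₀ (by linarith) hGt)).trans ?_
    rw [hpow, Complex.ofReal_mul, mul_smul]
    refine smul_le_smul_of_nonneg_left hGA (Complex.zero_le_real.2 (inv_nonneg.2 (by linarith)))

theorem dMaxSmooth_le_of_excess {l ε : ℝ} (ρ σ : DensityOperator H)
    (hε : ε = (trace (excess l ρ σ)).re) :
    dMaxSmooth (Real.sqrt ε) ρ σ ≤ (l : EReal) - log2 (ENNReal.ofReal (1 - ε)) := by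
  rcases lt_or_ge ε 1 with h1 | h1
  · rw [log2_ofReal (by linarith), ← EReal.coe_sub]
    exact dMaxSmooth_le_of_excess_lt_one ρ σ hε h1
  -- For `ε ≥ 1` the truncated `1 - ε` is `0`, so the right side is `∞`.
  · rw [ENNReal.ofReal_of_nonpos (by linarith), log2_zero]
    simp

theorem dMaxSmooth_anti {ε δ : ℝ} (h : ε ≤ δ) (ρ σ : DensityOperator H) :
    dMaxSmooth δ ρ σ ≤ dMaxSmooth ε ρ σ :=
  le_iInf₂ fun τ hτ => iInf₂_le τ (hτ.trans (ENNReal.ofReal_le_ofReal h))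

theorem dMaxSmooth_le_of_excess_le {l ε : ℝ} (h0 : 0 < ε) (h1 : ε < 1) (ρ σ : DensityOperator H)
    (h : (trace (excess l ρ σ)).re ≤ ε ^ 2) :
    dMaxSmooth ε ρ σ ≤ ((l - Real.logb 2 (1 - ε ^ 2) : ℝ) : EReal) := by
  have h2 : ε ^ 2 < 1 := pow_lt_one₀ h0.le h1 two_ne_zero
  refine (dMaxSmooth_anti (Real.sqrt_le_iff.2 ⟨h0.le, h⟩) ρ σ).trans
    ((dMaxSmooth_le_of_excess_lt_one ρ σ rfl (h.trans_lt h2)).trans ?_)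
  have := Real.logb_le_logb_of_le one_lt_two (by linarith : 0 < 1 - ε ^ 2)
    (by linarith : 1 - ε ^ 2 ≤ 1 - (trace (excess l ρ σ)).re)
  exact_mod_cast by linarith

/-- An upper bound on the smoothed max-relative entropy holds as soon as the excess is small above
a threshold. -/
theorem dMaxSmooth_le_of_forall {ε r : ℝ} (h0 : 0 < ε) (h1 : ε < 1) (ρ σ : DensityOperator H)
    (D : EReal) (h : ∀ l : ℝ, ε ^ 2 ≤ (trace (excess l ρ σ)).re → (l : EReal) ≤ D)
    (hr : r = Real.logb 2 (1 - ε ^ 2)) : dMaxSmooth ε ρ σ ≤ D - (r : EReal) := by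
  refine EReal.le_of_forall_lt_iff_le.1 fun z hz => ?_
  -- Any real `z > D - r` gives the threshold `l = z + r > D`; the excess there is below `ε²` by
  -- contraposition, and part 1 returns exactly `z`.
  have hz' : D < ((z + r : ℝ) : EReal) := by
    rw [EReal.coe_add]
    exact (EReal.sub_lt_iff (by simp) (by simp)).1 hz
  have := dMaxSmooth_le_of_excess_le (l := z + r) h0 h1 ρ σ
    (not_lt.1 fun hlt => absurd (h _ hlt.le) (not_le.2 hz'))
  rwa [← hr, add_sub_cancel_right] at this

theorem dMaxSmooth_le_dHyp {ε : ℝ} (h0 : 0 < ε) (h1 : ε < 1) (ρ σ : DensityOperator H) :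
    dMaxSmooth ε ρ σ ≤ dHyp (1 - ε ^ 2) ρ σ - ((Real.logb 2 (1 - ε ^ 2) : ℝ) : EReal) := by
  refine dMaxSmooth_le_of_forall h0 h1 ρ σ _ (fun l hl => ?_) rfl
  obtain ⟨P, hP, h⟩ := exists_proj_trace_excess l ρ σ
  have hρ := trace_proj_mul ρ.mem_posTraceClass hP
  have hσ := trace_proj_mul σ.mem_posTraceClass hP
  rw [← hρ, ← hσ] at h
  have hc : (0 : ℝ) < 2 ^ l := by positivity
  have hq : 0 ≤ (trace (P * σ.op)).re := hσ ▸ trace_re_nonneg (conj_proj_nonneg σ.nonneg hP)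
  have hp : (trace (P * ρ.op)).re ≤ 1 := by
    have hPn : ‖P‖ ≤ 1 := hP.norm_le
    have := trace_conj_le ρ.mem_posTraceClass hPn
    rwa [hP.isSelfAdjoint.star_eq, ρ.trace_eq_one, ← hρ, Complex.one_re] at this
  rw [dHyp, EReal.le_neg, ← EReal.coe_neg]
  have h2 : log2 (ENNReal.ofReal ((2 : ℝ) ^ (-l))) = ((-l : ℝ) : EReal) := by
    rw [log2_ofReal (by positivity), Real.logb_rpow two_pos (by norm_num)]
  rw [← h2]
  -- `P` is feasible since `Tr[P ρ] ≥ ε² = 1 - (1 - ε²)`, and `2^l Tr[P σ] ≤ Tr[P ρ] ≤ 1`.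
  refine log2_mono ((iInf₂_le P ⟨hP.nonneg, hP.le_one, ?_⟩).trans (ENNReal.ofReal_le_ofReal ?_))
  · rw [Real.rpow_neg two_pos.le, ← one_div, le_div_iff₀' hc]
    nlinarith [sq_nonneg ε]
  · nlinarith

/-- From `q ≤ 2^(-l) p` and `1 - α < 0` one gets `p^α q^(1-α) ≥ p 2^(l(α-1)) ≥ ε² 2^(l(α-1))`. The
logarithm divided by `α - 1` isolates `l`, and `ε²` is the source of the correction `2/(α-1)
log(1/ε)`. -/
theorem le_renyi_of_excess {ε α l f p q : ℝ} (h0 : 0 < ε) (hα : 1 < α) (hf : ε ^ 2 ≤ f)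
    (hq : 0 ≤ q) (hfp : f = p - 2 ^ l * q) :
    (l : EReal) ≤ ((1 / (α - 1) : ℝ) : EReal) *
      log2 (ENNReal.ofReal p ^ α * ENNReal.ofReal q ^ (1 - α)) +
        ((2 / (α - 1) * Real.logb 2 (1 / ε) : ℝ) : EReal) := by
  have hα' : 0 < α - 1 := by linarith
  have hc : (0 : ℝ) < 2 ^ l := by positivity
  have hε : 0 < ε ^ 2 := by positivity
  have hp : ε ^ 2 ≤ p := by nlinarith
  have hp0 : 0 < p := by linarith
  have key : ENNReal.ofReal (ε ^ 2 * 2 ^ (l * (α - 1))) ≤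
      ENNReal.ofReal p ^ α * ENNReal.ofReal q ^ (1 - α) := by
    rcases hq.eq_or_lt with rfl | hq
    · rw [ENNReal.ofReal_zero, ENNReal.zero_rpow_of_neg (by linarith), ENNReal.mul_top]
      · exact le_top
      · exact (ENNReal.rpow_pos (ENNReal.ofReal_pos.2 hp0) ENNReal.ofReal_ne_top).ne'
    · rw [ENNReal.ofReal_rpow_of_pos hp0, ENNReal.ofReal_rpow_of_pos hq,
        ← ENNReal.ofReal_mul (by positivity)]
      refine ENNReal.ofReal_le_ofReal ?_
      have h3 : q ≤ p / 2 ^ l := by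
        rw [le_div_iff₀ hc]
        linarith
      have h4 : (p / 2 ^ l) ^ (1 - α) ≤ q ^ (1 - α) :=
        Real.rpow_le_rpow_of_nonpos hq h3 (by linarith)
      calc ε ^ 2 * 2 ^ (l * (α - 1)) ≤ p * 2 ^ (l * (α - 1)) := by gcongr
        _ = p ^ α * (p / 2 ^ l) ^ (1 - α) := by
          rw [Real.div_rpow hp0.le hc.le, ← Real.rpow_mul two_pos.le, mul_div_assoc',
            ← Real.rpow_add hp0, div_eq_mul_inv, ← Real.rpow_neg two_pos.le]
          ring_nf
          rw [Real.rpow_one, mul_comm]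
        _ ≤ _ := by gcongr
  have h5 := log2_mono key
  rw [log2_ofReal (by positivity), Real.logb_mul hε.ne' (by positivity),
    Real.logb_rpow two_pos (by norm_num)] at h5
  have h6 : ((1 / (α - 1) : ℝ) : EReal) * ((Real.logb 2 (ε ^ 2) + l * (α - 1) : ℝ) : EReal) ≤ _ :=
    mul_le_mul_of_nonneg_left h5 (by exact_mod_cast (by positivity))
  refine le_trans (le_of_eq ?_) (add_le_add_left h6 _)
  rw [← EReal.coe_mul, ← EReal.coe_add, Real.logb_pow, one_div ε, Real.logb_inv]
  congr 1
  push_cast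
  field_simp
  ring

/-- The smoothed max-relative entropy is bounded by every quantity that dominates the Rényi
expression of a single outcome of all projective measurements. -/
theorem dMaxSmooth_le_of_measured {ε α : ℝ} (h0 : 0 < ε) (h1 : ε < 1) (hα : 1 < α)
    (ρ σ : DensityOperator H) (D : EReal)
    (hD : ∀ P : H →L[ℂ] H, IsStarProjection P → ((1 / (α - 1) : ℝ) : EReal) *
      log2 (ENNReal.ofReal (trace (P * ρ.op * P)).re ^ α *
        ENNReal.ofReal (trace (P * σ.op * P)).re ^ (1 - α)) ≤ D) :
    dMaxSmooth ε ρ σ ≤ D + ((2 / (α - 1) * Real.logb 2 (1 / ε) : ℝ) : EReal) +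
      ((Real.logb 2 (1 / (1 - ε ^ 2)) : ℝ) : EReal) := by
  have h := dMaxSmooth_le_of_forall h0 h1 ρ σ
    (D + ((2 / (α - 1) * Real.logb 2 (1 / ε) : ℝ) : EReal)) (fun l hl => ?_) rfl
  · rwa [one_div (1 - ε ^ 2), Real.logb_inv, EReal.coe_neg, ← sub_eq_add_neg]
  · obtain ⟨P, hP, h⟩ := exists_proj_trace_excess l ρ σ
    exact (le_renyi_of_excess h0 hα hl (trace_re_nonneg (conj_proj_nonneg σ.nonneg hP)) h).trans
      (add_le_add_left (hD P hP) _)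

end Smoothing

/-! ### The two-outcome measurement channel and data processing -/

section Measurement

variable {H : Type u} [NormedAddCommGroup H] [InnerProductSpace ℂ H] [CompleteSpace H]

/-- The positive operator `y ↦ ⟪x, y⟫ x`. -/
def rankOneSelf (x : H) : H →L[ℂ] H := InnerProductSpace.rankOne ℂ x x

omit [CompleteSpace H] in
theorem rankOneSelf_apply (x y : H) : rankOneSelf x y = ⟪x, y⟫_ℂ • x := rfl

theorem hasSum_trace_rankOneSelf (x : H) :
    HasSum (fun i => ⟪stdBasis H i, rankOneSelf x (stdBasis H i)⟫_ℂ) (⟪x, x⟫_ℂ) := by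
  refine ((stdBasis H).hasSum_inner_mul_inner x x).congr_fun fun i => ?_
  rw [rankOneSelf_apply, inner_smul_right]

theorem rankOneSelf_mem_posTraceClass (x : H) : rankOneSelf x ∈ posTraceClass H :=
  ⟨nonneg_iff_isPositive.2 (InnerProductSpace.isPositive_rankOne_self x),
    (hasSum_trace_rankOneSelf x).summable⟩

/-- The trace as a linear functional on the trace-class operators. -/
def traceLM : traceClass H →ₗ[ℂ] ℂ where
  toFun T := trace (T : H →L[ℂ] H)
  map_add' S T := trace_add S.2 T.2
  map_smul' c T := trace_smul c (T : H →L[ℂ] H)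

/-- Conjugation by a projection as a linear map on the trace-class operators. -/
def conjLM {P : H →L[ℂ] H} (hP : IsStarProjection P) : traceClass H →ₗ[ℂ] traceClass H where
  toFun T := ⟨P * T * P, conj_proj_mem_traceClass T.2 hP⟩
  map_add' S T := Subtype.ext (by simp [mul_add, add_mul])
  map_smul' c T := Subtype.ext (by simp)

variable {K : Type u} [NormedAddCommGroup K] [InnerProductSpace ℂ K] [CompleteSpace K]

/-- The linear map underlying the measurement of `P` and `1 - P`, the outcome being recorded in
the vectors `x` and `y`. -/
def measureLM {P : H →L[ℂ] H} (hP : IsStarProjection P) (x y : K) :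
    traceClass H →ₗ[ℂ] traceClass K :=
  (traceLM ∘ₗ conjLM hP).smulRight ⟨rankOneSelf x, posTraceClass_subset
    (rankOneSelf_mem_posTraceClass x)⟩ +
  (traceLM ∘ₗ conjLM hP.one_sub).smulRight ⟨rankOneSelf y, posTraceClass_subset
    (rankOneSelf_mem_posTraceClass y)⟩

theorem coe_measureLM {P : H →L[ℂ] H} (hP : IsStarProjection P) (x y : K) (T : traceClass H) :
    (measureLM hP x y T : K →L[ℂ] K) = trace (P * (T : H →L[ℂ] H) * P) • rankOneSelf x +
      trace ((1 - P) * (T : H →L[ℂ] H) * (1 - P)) • rankOneSelf y := rfl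

-- Complete positivity of one outcome: with the trace expanded in a basis `(b_k)`, the `k`-th
-- summand is the block form of `T` at the vectors `⟪x, v i⟫ P b_k`, hence non-negative.
omit [CompleteSpace K] in
theorem sum_trace_conj_nonneg {n : ℕ} {T : Fin n → Fin n → traceClass H}
    (hT : IsPositiveBlock fun i j => (T i j : H →L[ℂ] H)) {P : H →L[ℂ] H}
    (hP : IsStarProjection P) (x : K) (v : Fin n → K) :
    0 ≤ ∑ i, ∑ j, ⟪v i, (trace (P * (T i j : H →L[ℂ] H) * P) • rankOneSelf x) (v j)⟫_ℂ := by
  have h1 : ∀ i j, ⟪v i, (trace (P * (T i j : H →L[ℂ] H) * P) • rankOneSelf x) (v j)⟫_ℂ =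
      ∑' k, ⟪⟪x, v i⟫_ℂ • P (stdBasis H k),
        (T i j : H →L[ℂ] H) (⟪x, v j⟫_ℂ • P (stdBasis H k))⟫_ℂ := by
    intro i j
    have h2 : ∀ k, ⟪⟪x, v i⟫_ℂ • P (stdBasis H k),
        (T i j : H →L[ℂ] H) (⟪x, v j⟫_ℂ • P (stdBasis H k))⟫_ℂ =
        (⟪v i, x⟫_ℂ * ⟪x, v j⟫_ℂ) *
          ⟪stdBasis H k, (P * (T i j : H →L[ℂ] H) * P) (stdBasis H k)⟫_ℂ := by
      intro k
      have h3 := inner_star_right P (stdBasis H k) ((T i j : H →L[ℂ] H) (P (stdBasis H k)))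
      rw [hP.isSelfAdjoint.star_eq] at h3
      rw [map_smul, inner_smul_left, inner_smul_right, inner_conj_symm, mul_apply_eq_comp,
        mul_apply_eq_comp, h3, mul_assoc]
    simp_rw [h2]
    rw [tsum_mul_left, smul_apply, rankOneSelf_apply, inner_smul_right, inner_smul_right, trace]
    ring
  have hsum : ∀ i j, Summable fun k => ⟪⟪x, v i⟫_ℂ • P (stdBasis H k),
        (T i j : H →L[ℂ] H) (⟪x, v j⟫_ℂ • P (stdBasis H k))⟫_ℂ := by
    intro i j
    have h := (summable_of_mem_traceClass
      (conj_proj_mem_traceClass (T i j).2 hP)).mul_left (⟪v i, x⟫_ℂ * ⟪x, v j⟫_ℂ)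
    refine h.congr fun k => ?_
    have h3 := inner_star_right P (stdBasis H k) ((T i j : H →L[ℂ] H) (P (stdBasis H k)))
    rw [hP.isSelfAdjoint.star_eq] at h3
    rw [map_smul, inner_smul_left, inner_smul_right, inner_conj_symm, mul_apply_eq_comp,
      mul_apply_eq_comp, h3, mul_assoc]
  simp_rw [h1]
  have h4 : ∀ i, ∑ j, ∑' k, ⟪⟪x, v i⟫_ℂ • P (stdBasis H k),
        (T i j : H →L[ℂ] H) (⟪x, v j⟫_ℂ • P (stdBasis H k))⟫_ℂ =
      ∑' k, ∑ j, ⟪⟪x, v i⟫_ℂ • P (stdBasis H k),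
        (T i j : H →L[ℂ] H) (⟪x, v j⟫_ℂ • P (stdBasis H k))⟫_ℂ := fun i =>
    (Summable.tsum_finsetSum fun j _ => hsum i j).symm
  simp_rw [h4]
  rw [← Summable.tsum_finsetSum fun i _ => summable_sum fun j _ => hsum i j]
  exact tsum_nonneg fun k => hT fun i => ⟪x, v i⟫_ℂ • P (stdBasis H k)

/-- The channel that measures the projections `P` and `1 - P` and records the outcome in the unit
vectors `x` and `y`. -/
def measureChannel {P : H →L[ℂ] H} (hP : IsStarProjection P) {x y : K} (hx : ‖x‖ = 1)
    (hy : ‖y‖ = 1) : QuantumChannel H K where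
  toLinearMap := measureLM hP x y
  completelyPositive n T hT v := by
    simp only [coe_measureLM, add_apply, inner_add_right, Finset.sum_add_distrib]
    exact add_nonneg (sum_trace_conj_nonneg hT hP x v) (sum_trace_conj_nonneg hT hP.one_sub y v)
  trace_preserving T := by
    have hx' := posTraceClass_subset (rankOneSelf_mem_posTraceClass x)
    have hy' := posTraceClass_subset (rankOneSelf_mem_posTraceClass y)
    have h1 : trace (rankOneSelf x) = 1 := by
      rw [trace, (hasSum_trace_rankOneSelf x).tsum_eq, inner_self_eq_norm_sq_to_K, hx]
      simp
    have h2 : trace (rankOneSelf y) = 1 := by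
      rw [trace, (hasSum_trace_rankOneSelf y).tsum_eq, inner_self_eq_norm_sq_to_K, hy]
      simp
    rw [coe_measureLM, trace_add (Submodule.smul_mem _ _ hx') (Submodule.smul_mem _ _ hy'),
      trace_smul, trace_smul, h1, h2, mul_one, mul_one, trace_proj_add_trace_compl T.2 hP]

/-- The distribution of the outcomes of the measurement of `P` (`false`) and `1 - P` (`true`). -/
def measureProb (P : H →L[ℂ] H) (ρ : DensityOperator H) (i : ULift.{u} Bool) : ℝ≥0 :=
  bif i.down then (trace ((1 - P) * ρ.op * (1 - P))).re.toNNReal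
  else (trace (P * ρ.op * P)).re.toNNReal

theorem trace_eq_toNNReal {T : H →L[ℂ] H} (hT : 0 ≤ T) :
    trace T = (((trace T).re.toNNReal : ℝ) : ℂ) := by
  have h := Complex.le_def.1 (trace_nonneg hT)
  rw [Real.coe_toNNReal _ h.1]
  exact Complex.ext (by simp) (by simpa using h.2.symm)

theorem mapState_measureChannel_apply {P : H →L[ℂ] H} (hP : IsStarProjection P)
    (e : HilbertBasis (ULift.{u} Bool) ℂ K) (ρ : DensityOperator H) (i : ULift.{u} Bool) :
    ((measureChannel hP (e.orthonormal.1 ⟨false⟩) (e.orthonormal.1 ⟨true⟩)).mapState ρ).op (e i) =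
      ((measureProb P ρ i : ℝ) : ℂ) • e i := by
  change (measureLM hP (e ⟨false⟩) (e ⟨true⟩) ⟨ρ.op, ρ.mem_traceClass⟩ : K →L[ℂ] K) (e i) = _
  have h01 : ⟪e ⟨false⟩, e ⟨true⟩⟫_ℂ = 0 := e.orthonormal.2 (by simp)
  have h10 : ⟪e ⟨true⟩, e ⟨false⟩⟫_ℂ = 0 := e.orthonormal.2 (by simp)
  have hn : ∀ i, ⟪e i, e i⟫_ℂ = 1 := fun i => by
    rw [inner_self_eq_norm_sq_to_K, e.orthonormal.1 i]
    simp
  rw [coe_measureLM, add_apply, smul_apply, smul_apply, rankOneSelf_apply, rankOneSelf_apply]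
  obtain ⟨_ | _⟩ := i
  · rw [hn, h10, zero_smul, smul_zero, add_zero, one_smul]
    exact congrArg (· • _) (trace_eq_toNNReal (conj_proj_nonneg ρ.nonneg hP))
  · rw [hn, h01, zero_smul, smul_zero, zero_add, one_smul]
    exact congrArg (· • _) (trace_eq_toNNReal (conj_proj_nonneg ρ.nonneg hP.one_sub))

theorem measured_le_of_isQuantumRenyiDivergence [TopologicalSpace.SeparableSpace H] {α : ℝ}
    (hα : 1 < α) {D : StateDivergence.{u}} (hD : IsQuantumRenyiDivergence α D)
    (ρ σ : DensityOperator H) {P : H →L[ℂ] H} (hP : IsStarProjection P) :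
    ((1 / (α - 1) : ℝ) : EReal) * log2 (ENNReal.ofReal (trace (P * ρ.op * P)).re ^ α *
      ENNReal.ofReal (trace (P * σ.op * P)).re ^ (1 - α)) ≤ D H ρ σ := by
  let e : HilbertBasis (ULift.{u} Bool) ℂ (EuclideanSpace ℂ (ULift.{u} Bool)) :=
    (EuclideanSpace.basisFun (ULift.{u} Bool) ℂ).toHilbertBasis
  refine le_trans ?_ (hD.data_processing H (EuclideanSpace ℂ (ULift.{u} Bool))
    (measureChannel hP (e.orthonormal.1 ⟨false⟩) (e.orthonormal.1 ⟨true⟩)) ρ σ)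
  rw [hD.classical (EuclideanSpace ℂ (ULift.{u} Bool)) _ _ _ e (measureProb P ρ) (measureProb P σ)
    (mapState_measureChannel_apply hP e ρ) (mapState_measureChannel_apply hP e σ), classicalRenyi]
  refine mul_le_mul_of_nonneg_left (log2_mono ?_) ?_
  -- All outcomes contribute non-negative terms, so the one for `P` alone is a lower bound.
  · exact ENNReal.le_tsum (f := fun i => (measureProb P ρ i : ℝ≥0∞) ^ α *
      (measureProb P σ i : ℝ≥0∞) ^ (1 - α)) ⟨false⟩
  · have : 0 < α - 1 := by linarith
    exact_mod_cast (by positivity : (0 : ℝ) ≤ 1 / (α - 1))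

end Measurement

/-! ### Eigenbases of positive trace-class operators -/

section Eigenbasis

variable {H : Type u} [NormedAddCommGroup H] [InnerProductSpace ℂ H] [CompleteSpace H]

theorem enorm_apply_sq_le (A : H →L[ℂ] H) (x : H) : ‖A x‖ₑ ^ 2 ≤ hsNormSq A * ‖x‖ₑ ^ 2 := by
  rw [← hsNormSq_star, hsNormSq, ← tsum_enorm_inner_sq (stdBasis H), ← ENNReal.tsum_mul_right]
  refine ENNReal.tsum_le_tsum fun i => ?_
  rw [← inner_star_left, ← mul_pow, ← ofReal_norm, ← ofReal_norm, ← ofReal_norm,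
    ← ENNReal.ofReal_mul (norm_nonneg _)]
  gcongr
  exact norm_inner_le_norm _ _

theorem norm_sq_le_toReal_hsNormSq {A : H →L[ℂ] H} (hA : hsNormSq A ≠ ∞) :
    ‖A‖ ^ 2 ≤ (hsNormSq A).toReal := by
  refine (Real.le_sqrt (norm_nonneg _) ENNReal.toReal_nonneg).1
    (A.opNorm_le_bound (Real.sqrt_nonneg _) fun x => ?_)
  refine (sq_le_sq₀ (norm_nonneg _) (by positivity)).1 ?_
  rw [mul_pow, Real.sq_sqrt ENNReal.toReal_nonneg]
  have := ENNReal.toReal_mono (ENNReal.mul_ne_top hA (by simp)) (enorm_apply_sq_le A x)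
  simpa using this

omit [CompleteSpace H] in
theorem isCompactOperator_rankOneSelf (x : H) : IsCompactOperator (rankOneSelf x) := by
  have h : IsCompactOperator (innerSL ℂ x) := isCompactOperator_of_locallyCompactSpace_dom (innerSL ℂ x)
  exact h.clm_comp (ContinuousLinearMap.toSpanSingleton ℂ x)

/-- `A` is a norm limit of the finite-rank operators `A Q s`, with `Q s` the projection onto
finitely many basis vectors: the operator norm is dominated by the Hilbert-Schmidt norm, and the
error is the tail of a convergent series. -/
theorem isCompactOperator_of_hsNormSq_ne_top {A : H →L[ℂ] H} (hA : hsNormSq A ≠ ∞) :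
    IsCompactOperator A := by
  classical
  set e := stdBasis H with he
  let Q : Finset (stdIndex H) → H →L[ℂ] H := fun s => ∑ i ∈ s, rankOneSelf (e i)
  have hQ : ∀ s i, Q s (e i) = if i ∈ s then e i else 0 := by
    intro s i
    simp only [Q, sum_apply, rankOneSelf_apply,
      orthonormal_iff_ite.1 e.orthonormal, ite_smul, one_smul, zero_smul]
    rw [Finset.sum_ite_eq' s i (fun j => e j)]
  have hcomp : ∀ s, IsCompactOperator (Q s) := by
    intro s
    induction s using Finset.induction_on with
    | empty => simpa [Q] using isCompactOperator_zero
    | insert i s hi hs =>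
      simp only [Q, Finset.sum_insert hi]
      exact (isCompactOperator_rankOneSelf _).add hs
  have hhs : ∀ s, hsNormSq (A * Q s - A) = ∑' i : {i // i ∉ s}, ‖A (e i)‖ₑ ^ 2 := by
    intro s
    refine Eq.trans ?_ (tsum_subtype {i | i ∉ s} (fun i => ‖A (e i)‖ₑ ^ 2)).symm
    rw [hsNormSq]
    refine tsum_congr fun i => ?_
    rw [sub_apply, mul_apply_eq_comp, ← he, hQ, Set.indicator_apply]
    by_cases hi : i ∈ s <;> simp [hi]
  have ht := ENNReal.tendsto_tsum_compl_atTop_zero hA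
  have hfin : ∀ s, hsNormSq (A * Q s - A) ≠ ∞ := by
    intro s
    rw [hhs]
    exact ne_top_of_le_ne_top hA
      (ENNReal.tsum_comp_le_tsum_of_injective Subtype.val_injective fun i => ‖A (e i)‖ₑ ^ 2)
  have ht2 : Filter.Tendsto (fun s => ‖A * Q s - A‖ ^ 2) Filter.atTop (nhds 0) := by
    have h0 := (ENNReal.tendsto_toReal ENNReal.zero_ne_top).comp ht
    refine squeeze_zero (fun _ => by positivity) (fun s => ?_) h0
    refine (norm_sq_le_toReal_hsNormSq (hfin s)).trans_eq ?_
    rw [hhs]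
    rfl
  have ht3 : Filter.Tendsto (fun s => A * Q s) Filter.atTop (nhds A) := by
    rw [tendsto_iff_norm_sub_tendsto_zero]
    have := ht2.sqrt
    simpa using this
  exact isCompactOperator_of_tendsto ht3 (Filter.Eventually.of_forall fun s =>
    (hcomp s).clm_comp A)

theorem exists_eigenbasis {T : H →L[ℂ] H} (hT : T ∈ posTraceClass H) :
    ∃ (ι : Type u) (e : HilbertBasis ι ℂ H) (p : ι → ℝ≥0),
      ∀ i, T (e i) = ((p i : ℝ) : ℂ) • e i := by
  have hpos := nonneg_iff_isPositive.1 hT.1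
  have hcomp : IsCompactOperator T := by
    have := (isCompactOperator_of_hsNormSq_ne_top (hsNormSq_sqrt_ne_top hT)).clm_comp (CFC.sqrt T)
    rwa [← ContinuousLinearMap.coe_comp, ← ContinuousLinearMap.mul_def,
      CFC.sqrt_mul_sqrt_self T hT.1] at this
  have hsymm : T.toLinearMap.IsSymmetric := hpos.isSymmetric
  have hbot := ContinuousLinearMap.orthogonalComplement_iSup_eigenspaces_eq_bot hcomp hsymm
  have hc : ∀ μ : ℂ, CompleteSpace (Module.End.eigenspace T.toLinearMap μ) := fun μ => by
    have : (Module.End.eigenspace T.toLinearMap μ : Set H) = {x | T x = μ • x} := by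
      ext x
      exact Module.End.mem_eigenspace_iff
    refine IsClosed.completeSpace_coe (hs := ?_)
    rw [this]
    exact isClosed_eq T.continuous (continuous_const_smul μ)
  -- Bases of all eigenspaces, the kernel included, are put together; the spectral theorem for
  -- compact self-adjoint operators makes the union complete.
  let v : (Σ μ : ℂ, stdIndex (Module.End.eigenspace T.toLinearMap μ)) → H :=
    fun a => (stdBasis (Module.End.eigenspace T.toLinearMap a.1) a.2 : H)
  have hv : Orthonormal ℂ v :=
    hsymm.orthogonalFamily_eigenspaces.orthonormal_sigma_orthonormal
      fun μ => (stdBasis (Module.End.eigenspace T.toLinearMap μ)).orthonormal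
  have hvT : ∀ a, T (v a) = a.1 • v a := fun a =>
    Module.End.mem_eigenspace_iff.1 (stdBasis (Module.End.eigenspace T.toLinearMap a.1) a.2).2
  have hsp : (Submodule.span ℂ (Set.range v))ᗮ = ⊥ := by
    rw [eq_bot_iff, ← hbot, ← Submodule.iInf_orthogonal]
    refine le_iInf fun μ x hx => ?_
    rw [← Submodule.orthogonalProjectionOnto_eq_zero_iff]
    set y := (Module.End.eigenspace T.toLinearMap μ).orthogonalProjectionOnto x with hy
    have h0 : ∀ k, ⟪stdBasis (Module.End.eigenspace T.toLinearMap μ) k, y⟫_ℂ = 0 := fun k => by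
      rw [hy, Submodule.inner_orthogonalProjectionOnto_eq_of_mem_left]
      exact (Submodule.mem_orthogonal _ _).1 hx _ (Submodule.subset_span ⟨⟨μ, k⟩, rfl⟩)
    have h1 := hasSum_norm_inner_sq (stdBasis (Module.End.eigenspace T.toLinearMap μ)) y
    simp only [h0, norm_zero, ne_eq, OfNat.ofNat_ne_zero, not_false_eq_true, zero_pow] at h1
    have h2 := h1.unique hasSum_zero
    simpa using h2
  refine ⟨_, HilbertBasis.mkOfOrthogonalEqBot hv hsp, fun a => a.1.re.toNNReal, fun a => ?_⟩
  rw [HilbertBasis.coe_mkOfOrthogonalEqBot, hvT]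
  congr 1
  have h := hpos.inner_nonneg_right (v a)
  rw [hvT, inner_smul_right, inner_self_eq_norm_sq_to_K, hv.1 a] at h
  simp only [Complex.coe_algebraMap, Complex.ofReal_one, one_pow, mul_one] at h
  rw [Real.coe_toNNReal _ (Complex.le_def.1 h).1]
  exact Complex.ext (by simp) (by simpa using (Complex.le_def.1 h).2.symm)

theorem sqrt_apply_of_eigenvector {T : H →L[ℂ] H} (hT : 0 ≤ T) {x : H} {p : ℝ≥0}
    (hx : T x = ((p : ℝ) : ℂ) • x) : CFC.sqrt T x = ((Real.sqrt p : ℝ) : ℂ) • x := by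
  set R := CFC.sqrt T with hR
  set s := Real.sqrt p
  have hss : (s : ℂ) * s = ((p : ℝ) : ℂ) := by
    rw [← Complex.ofReal_mul, Real.mul_self_sqrt p.coe_nonneg]
  have hRR : R (R x) = ((p : ℝ) : ℂ) • x := by
    rw [← mul_apply_eq_comp, CFC.sqrt_mul_sqrt_self T hT, hx]
  -- From `R² x = s² x` follows `R y = -s y`. As `R ≥ 0`, this forces `y = 0` when `s > 0`; for `s =
  -- 0`, `R² x = 0` gives `R x = 0`.
  set y := R x - (s : ℂ) • x with hy
  have hRy : R y = -(s : ℂ) • y := by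
    rw [hy, map_sub, map_smul, hRR, ← hss, neg_smul, smul_sub, smul_smul]
    abel
  have hpos := (nonneg_iff_isPositive.1 (CFC.sqrt_nonneg T)).inner_nonneg_right
  rw [← hR] at hpos
  have h1 := hpos y
  rw [hRy, neg_smul, inner_neg_right, inner_smul_right, inner_self_eq_norm_sq_to_K] at h1
  have h2 : s * ‖y‖ ^ 2 ≤ 0 := by
    have h : -((s : ℂ) * ((‖y‖ : ℝ) : ℂ) ^ 2) = ((-(s * ‖y‖ ^ 2) : ℝ) : ℂ) := by push_cast; rfl
    have h1' : (0 : ℂ) ≤ ((-(s * ‖y‖ ^ 2) : ℝ) : ℂ) := h ▸ h1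
    linarith [Complex.zero_le_real.1 h1']
  have h3 : 0 ≤ s := Real.sqrt_nonneg _
  refine sub_eq_zero.1 ?_
  rcases h3.eq_or_lt with h4 | h4
  · rw [← hss, ← h4, Complex.ofReal_zero, mul_zero, zero_smul] at hRR
    have hRx := apply_eq_zero_of_self_apply (CFC.sqrt_nonneg T).isSelfAdjoint hRR
    rw [hR, hRx, ← h4, Complex.ofReal_zero, zero_smul, sub_zero]
  · have : ‖y‖ ^ 2 ≤ 0 := by nlinarith
    exact norm_eq_zero.1 (by nlinarith [norm_nonneg y, sq_nonneg ‖y‖])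

/-- The trace of the compression `P T P` in terms of the eigenvalues of `T`. -/
theorem hasSum_trace_conj_eigenbasis {T P : H →L[ℂ] H} (hT : T ∈ posTraceClass H)
    (hP : IsStarProjection P) {ι : Type*} (e : HilbertBasis ι ℂ H) {p : ι → ℝ≥0}
    (he : ∀ i, T (e i) = ((p i : ℝ) : ℂ) • e i) :
    HasSum (fun i => (p i : ℝ) * ‖P (e i)‖ ^ 2) (trace (P * T * P)).re := by
  have h := trace_conj hT.1 P
  rw [hP.isSelfAdjoint.star_eq] at h
  have hfin : hsNormSq (CFC.sqrt T * P) ≠ ∞ := hsNormSq_mul_ne_top' P (hsNormSq_sqrt_ne_top hT)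
  have h2 : hsNormSq (CFC.sqrt T * P) =
      ∑' i, ‖((Real.sqrt (p i) : ℝ) : ℂ) • P (e i)‖ₑ ^ 2 := by
    rw [← hsNormSq_star, star_mul, star_sqrt, hP.isSelfAdjoint.star_eq, hsNormSq_eq_tsum e]
    refine tsum_congr fun i => ?_
    rw [mul_apply_eq_comp, sqrt_apply_of_eigenvector hT.1 (he i), map_smul]
  have h3 : ∀ i, ‖((Real.sqrt (p i) : ℝ) : ℂ) • P (e i)‖ ^ 2 = (p i : ℝ) * ‖P (e i)‖ ^ 2 := by
    intro i
    rw [norm_smul, mul_pow, Complex.norm_real, Real.norm_of_nonneg (Real.sqrt_nonneg _),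
      Real.sq_sqrt (p i).coe_nonneg]
  rw [h, Complex.ofReal_re, h2]
  rw [h2] at hfin
  have h4 := tsum_enorm_sq_ne_top_iff.1 hfin
  simp_rw [h3] at h4
  convert h4.hasSum using 1
  rw [ENNReal.tsum_toReal_eq (by simp)]
  refine tsum_congr fun i => ?_
  rw [ENNReal.toReal_pow, toReal_enorm, h3]

end Eigenbasis

/-! ### Complex interpolation for the Petz quantity -/

section Interpolation

variable {H : Type u} [NormedAddCommGroup H] [InnerProductSpace ℂ H] [CompleteSpace H]

omit [CompleteSpace H] in
theorem norm_sq_sum_smul {ι : Type*} {e : ι → H} (he : Orthonormal ℂ e) (s : Finset ι)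
    (c : ι → ℂ) : ‖∑ i ∈ s, c i • e i‖ ^ 2 = ∑ i ∈ s, ‖c i‖ ^ 2 := by
  have h := he.inner_sum c c s
  rw [inner_self_eq_norm_sq_to_K] at h
  simp_rw [Complex.conj_mul'] at h
  refine Complex.ofReal_injective ?_
  push_cast
  exact h

theorem sum_mul_le_sqrt_mul_sqrt_of_sum_le {ι : Type*} (s : Finset ι) (f g : ι → ℝ) {a b : ℝ}
    (ha : ∑ i ∈ s, f i ^ 2 ≤ a) (hb : ∑ i ∈ s, g i ^ 2 ≤ b) :
    ∑ i ∈ s, f i * g i ≤ Real.sqrt a * Real.sqrt b :=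
  (Real.sum_mul_le_sqrt_mul_sqrt s f g).trans (by gcongr)

omit [CompleteSpace H] in
/-- The Cauchy-Schwarz inequality for the Hilbert-Schmidt inner product of finite sums of rank-one
operators. -/
theorem norm_sum_inner_mul_inner_le {ι κ : Type*} {e : ι → H} {f : κ → H} (he : Orthonormal ℂ e)
    (hf : Orthonormal ℂ f) (I : Finset ι) (J : Finset κ) (a : ι → ℂ) (b : κ → ℂ) (x : ι → H)
    (y : κ → H) :
    ‖∑ i ∈ I, ∑ j ∈ J, a i * b j * (⟪e i, f j⟫_ℂ * ⟪y j, x i⟫_ℂ)‖ ≤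
      Real.sqrt (∑ i ∈ I, ‖a i‖ ^ 2 * ‖x i‖ ^ 2) * Real.sqrt (∑ j ∈ J, ‖b j‖ ^ 2 * ‖y j‖ ^ 2) := by
  classical
  -- Only finitely many `x i` and `y j` occur, so a basis of their span gives a finite resolution of
  -- `⟪y j, x i⟫`, with no convergence question.
  set U : Submodule ℂ H := Submodule.span ℂ ((I.image x ∪ J.image y : Finset H) : Set H) with hU
  have hx : ∀ i ∈ I, x i ∈ U := fun i hi => Submodule.subset_span (by
    simp only [Finset.coe_union, Finset.coe_image]
    exact Or.inl ⟨i, hi, rfl⟩)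
  have hy : ∀ j ∈ J, y j ∈ U := fun j hj => Submodule.subset_span (by
    simp only [Finset.coe_union, Finset.coe_image]
    exact Or.inr ⟨j, hj, rfl⟩)
  have hfin : FiniteDimensional ℂ U := FiniteDimensional.span_finset ℂ _
  let g := stdOrthonormalBasis ℂ U
  have hg : ∀ u ∈ U, ∑ k, ‖⟪(g k : H), u⟫_ℂ‖ ^ 2 = ‖u‖ ^ 2 := fun u hu =>
    g.sum_sq_norm_inner_right ⟨u, hu⟩
  have hg2 : ∀ u ∈ U, ∀ w ∈ U, ∑ k, ⟪u, (g k : H)⟫_ℂ * ⟪(g k : H), w⟫_ℂ = ⟪u, w⟫_ℂ :=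
    fun u hu w hw => g.sum_inner_mul_inner ⟨u, hu⟩ ⟨w, hw⟩
  have h1 : ∑ i ∈ I, ∑ j ∈ J, a i * b j * (⟪e i, f j⟫_ℂ * ⟪y j, x i⟫_ℂ) =
      ∑ k, ⟪∑ i ∈ I, (starRingEnd ℂ) (a i * ⟪(g k : H), x i⟫_ℂ) • e i,
        ∑ j ∈ J, (b j * ⟪y j, (g k : H)⟫_ℂ) • f j⟫_ℂ := by
    simp_rw [sum_inner, inner_sum, inner_smul_left, inner_smul_right, Complex.conj_conj]
    rw [Finset.sum_comm' (t' := I) (s' := fun _ => Finset.univ) (by simp)]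
    refine Finset.sum_congr rfl fun i hi => ?_
    rw [Finset.sum_comm]
    refine Finset.sum_congr rfl fun j hj => ?_
    rw [← hg2 _ (hy j hj) _ (hx i hi), Finset.mul_sum, Finset.mul_sum]
    refine Finset.sum_congr rfl fun k _ => ?_
    ring
  rw [h1]
  refine (norm_sum_le _ _).trans ((Finset.sum_le_sum fun k _ => norm_inner_le_norm _ _).trans
    (sum_mul_le_sqrt_mul_sqrt_of_sum_le _ _ _ (le_of_eq ?_) (le_of_eq ?_)))
  · simp_rw [norm_sq_sum_smul he, RCLike.norm_conj, norm_mul, mul_pow]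
    rw [Finset.sum_comm]
    refine Finset.sum_congr rfl fun i hi => ?_
    rw [← Finset.mul_sum, hg _ (hx i hi)]
  · simp_rw [norm_sq_sum_smul hf, norm_mul, mul_pow]
    rw [Finset.sum_comm]
    refine Finset.sum_congr rfl fun j hj => ?_
    simp_rw [norm_inner_symm (y j)]
    rw [← Finset.mul_sum, hg _ (hy j hj)]

/-- A truncation of `Tr[P ρ^(1/2 + z) σ^(1/2 - z) P]`. -/
def interpFun {ι κ : Type*} (e : ι → H) (f : κ → H) (p : ι → ℝ≥0) (q : κ → ℝ≥0) (P : H →L[ℂ] H)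
    (I : Finset ι) (J : Finset κ) (z : ℂ) : ℂ :=
  ∑ i ∈ I, ∑ j ∈ J, ((p i : ℝ) : ℂ) ^ (1 / 2 + z) * ((q j : ℝ) : ℂ) ^ (1 / 2 - z) *
    (⟪e i, f j⟫_ℂ * ⟪P (f j), P (e i)⟫_ℂ)

variable {ι κ : Type*} {e : ι → H} {f : κ → H} {p : ι → ℝ≥0} {q : κ → ℝ≥0} {P : H →L[ℂ] H}
  {I : Finset ι} {J : Finset κ}

omit [CompleteSpace H] in
theorem differentiable_interpFun (hp : ∀ i ∈ I, 0 < p i) (hq : ∀ j ∈ J, 0 < q j) :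
    Differentiable ℂ (interpFun e f p q P I J) := by
  unfold interpFun
  refine Differentiable.fun_sum fun i hi => Differentiable.fun_sum fun j hj => ?_
  have h1 : ((p i : ℝ) : ℂ) ≠ 0 := by exact_mod_cast (hp i hi).ne'
  have h2 : ((q j : ℝ) : ℂ) ≠ 0 := by exact_mod_cast (hq j hj).ne'
  refine Differentiable.mul_const (Differentiable.mul ?_ ?_) _
  · exact Differentiable.const_cpow (by fun_prop) (Or.inl h1)
  · exact Differentiable.const_cpow (by fun_prop) (Or.inl h2)

theorem norm_coe_cpow {x : ℝ≥0} (hx : 0 < x) (z : ℂ) : ‖((x : ℝ) : ℂ) ^ z‖ = (x : ℝ) ^ z.re :=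
  Complex.norm_cpow_eq_rpow_re_of_pos (by exact_mod_cast hx) z

omit [CompleteSpace H] in
theorem norm_interpFun_of_re_eq_zero (he : Orthonormal ℂ e) (hf : Orthonormal ℂ f)
    (hp : ∀ i ∈ I, 0 < p i) (hq : ∀ j ∈ J, 0 < q j) {z : ℂ} (hz : z.re = 0) :
    ‖interpFun e f p q P I J z‖ ≤ Real.sqrt (∑ i ∈ I, (p i : ℝ) * ‖P (e i)‖ ^ 2) *
      Real.sqrt (∑ j ∈ J, (q j : ℝ) * ‖P (f j)‖ ^ 2) := by
  have hsq : ∀ x : ℝ≥0, ((x : ℝ) ^ (1 / 2 : ℝ)) ^ 2 = x := fun x => by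
    rw [← Real.sqrt_eq_rpow, Real.sq_sqrt x.coe_nonneg]
  refine (norm_sum_inner_mul_inner_le he hf I J _ _ _ _).trans_eq ?_
  congr 2
  · refine Finset.sum_congr rfl fun i hi => ?_
    rw [norm_coe_cpow (hp i hi)]
    simp [hz, hsq, -one_div]
  · refine Finset.sum_congr rfl fun j hj => ?_
    rw [norm_coe_cpow (hq j hj)]
    simp [hz, hsq, -one_div]

/-- Cauchy-Schwarz over pairs, with one factor `p^(1/2) |⟪f j, P e i⟫|` split off. Bessel's
inequality sums its square over `j`; the other factor becomes the Petz sum when `2 Re z = α`. -/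
theorem norm_interpFun_le (hf : Orthonormal ℂ f) (hP : IsStarProjection P)
    (hp : ∀ i ∈ I, 0 < p i) (hq : ∀ j ∈ J, 0 < q j) (z : ℂ) :
    ‖interpFun e f p q P I J z‖ ≤ Real.sqrt (∑ i ∈ I, (p i : ℝ) * ‖P (e i)‖ ^ 2) *
      Real.sqrt (∑ i ∈ I, ∑ j ∈ J, (p i : ℝ) ^ (2 * z.re) * (q j : ℝ) ^ (1 - 2 * z.re) *
        ‖⟪e i, f j⟫_ℂ‖ ^ 2) := by
  have hpf : ∀ i j, ⟪P (f j), P (e i)⟫_ℂ = ⟪f j, P (e i)⟫_ℂ := fun i j => by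
    rw [← inner_star_right, hP.isSelfAdjoint.star_eq, ← mul_apply_eq_comp, hP.isIdempotentElem.eq]
  rw [interpFun, ← Finset.sum_product']
  refine (norm_sum_le _ _).trans ?_
  have h1 : ∀ ij ∈ I ×ˢ J, ‖((p ij.1 : ℝ) : ℂ) ^ (1 / 2 + z) * ((q ij.2 : ℝ) : ℂ) ^ (1 / 2 - z) *
      (⟪e ij.1, f ij.2⟫_ℂ * ⟪P (f ij.2), P (e ij.1)⟫_ℂ)‖ =
      ((p ij.1 : ℝ) ^ (1 / 2 : ℝ) * ‖⟪f ij.2, P (e ij.1)⟫_ℂ‖) *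
        ((p ij.1 : ℝ) ^ z.re * (q ij.2 : ℝ) ^ (1 / 2 - z.re) * ‖⟪e ij.1, f ij.2⟫_ℂ‖) := by
    intro ij hij
    obtain ⟨hi, hj⟩ := Finset.mem_product.1 hij
    rw [hpf, norm_mul, norm_mul, norm_mul, norm_coe_cpow (hp _ hi), norm_coe_cpow (hq _ hj)]
    have h2 : (1 / 2 + z).re = 1 / 2 + z.re := by simp
    have h3 : (1 / 2 - z).re = 1 / 2 - z.re := by simp
    rw [h2, h3, Real.rpow_add (by exact_mod_cast hp _ hi)]
    ring
  rw [Finset.sum_congr rfl h1]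
  refine sum_mul_le_sqrt_mul_sqrt_of_sum_le _ _ _ ?_ (le_of_eq ?_)
  · rw [Finset.sum_product]
    refine Finset.sum_le_sum fun i hi => ?_
    simp_rw [mul_pow]
    rw [← Finset.mul_sum, ← Real.sqrt_eq_rpow, Real.sq_sqrt (p i).coe_nonneg]
    gcongr
    exact hf.sum_inner_products_le _
  · rw [Finset.sum_product]
    refine Finset.sum_congr rfl fun i hi => Finset.sum_congr rfl fun j hj => ?_
    rw [mul_pow, mul_pow, ← Real.rpow_natCast, ← Real.rpow_natCast,
      ← Real.rpow_mul (p i).coe_nonneg, ← Real.rpow_mul (q j).coe_nonneg]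
    congr 3 <;> push_cast <;> ring

theorem norm_interpFun_half_le (he : Orthonormal ℂ e) (hf : Orthonormal ℂ f)
    (hP : IsStarProjection P) (hp : ∀ i ∈ I, 0 < p i) (hq : ∀ j ∈ J, 0 < q j) {α : ℝ}
    (hα : 1 < α) {a b c : ℝ} (ha : ∑ i ∈ I, (p i : ℝ) * ‖P (e i)‖ ^ 2 ≤ a)
    (hb : ∑ j ∈ J, (q j : ℝ) * ‖P (f j)‖ ^ 2 ≤ b)
    (hc : ∑ i ∈ I, ∑ j ∈ J, (p i : ℝ) ^ α * (q j : ℝ) ^ (1 - α) * ‖⟪e i, f j⟫_ℂ‖ ^ 2 ≤ c) :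
    ‖interpFun e f p q P I J (1 / 2)‖ ≤
      (Real.sqrt a * Real.sqrt b) ^ (1 - 1 / α) * (Real.sqrt a * Real.sqrt c) ^ (1 / α) := by
  have hα0 : 0 < α := by linarith
  -- Rescaling by `α/2` maps the unit strip to `0 ≤ Re z ≤ α/2` and the point `1/α` to `1/2`.
  let F : ℂ → ℂ := fun z => interpFun e f p q P I J ((α / 2 : ℝ) * z)
  have hF : Differentiable ℂ F := (differentiable_interpFun hp hq).comp (by fun_prop)
  have hre : ∀ z : ℂ, (((α / 2 : ℝ) : ℂ) * z).re = α / 2 * z.re := fun z => by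
    rw [Complex.re_ofReal_mul]
  have h := Complex.HadamardThreeLines.norm_le_interp_of_mem_verticalClosedStrip₀₁' F
    (z := ((1 / α : ℝ) : ℂ)) (a := Real.sqrt a * Real.sqrt b) (b := Real.sqrt a * Real.sqrt c)
    ?_ hF.diffContOnCl ?_ ?_ ?_
  · rw [Complex.ofReal_re] at h
    have h4 : ((α / 2 : ℝ) : ℂ) * ((1 / α : ℝ) : ℂ) = 1 / 2 := by
      rw [← Complex.ofReal_mul, show α / 2 * (1 / α) = 1 / 2 by field_simp]
      push_cast
      rfl
    simpa only [F, h4] using h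
  · simp only [Complex.HadamardThreeLines.verticalClosedStrip, Set.mem_preimage, Complex.ofReal_re]
    exact ⟨by positivity, by rw [div_le_one hα0]; exact hα.le⟩
  · refine ⟨∑ i ∈ I, ∑ j ∈ J, (((p i : ℝ) ^ (1 / 2 + α / 2) + (p i : ℝ) ^ (1 / 2 : ℝ)) *
      ((q j : ℝ) ^ (1 / 2 - α / 2) + (q j : ℝ) ^ (1 / 2 : ℝ)) *
        ‖⟪e i, f j⟫_ℂ * ⟪P (f j), P (e i)⟫_ℂ‖), ?_⟩
    rintro _ ⟨z, hz, rfl⟩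
    simp only [Complex.HadamardThreeLines.verticalClosedStrip, Set.mem_preimage] at hz
    have hr0 : 0 ≤ α / 2 * z.re := mul_nonneg (by positivity) hz.1
    have hr1 : α / 2 * z.re ≤ α / 2 := mul_le_of_le_one_right (by positivity) hz.2
    -- A power with intermediate exponent is at most the sum of the powers at the end points,
    -- whichever side of `1` the base is on; this bounds `F` on the strip.
    have hmono : ∀ {x u v w : ℝ}, 0 < x → u ≤ v → v ≤ w → x ^ v ≤ x ^ u + x ^ w := by
      intro x u v w hx huv hvw
      rcases le_total 1 x with h1 | h1
      · exact (Real.rpow_le_rpow_of_exponent_le h1 hvw).trans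
          (le_add_of_nonneg_left (by positivity))
      · exact (Real.rpow_le_rpow_of_exponent_ge hx h1 huv).trans
          (le_add_of_nonneg_right (by positivity))
    refine (norm_sum_le _ _).trans (Finset.sum_le_sum fun i hi =>
      (norm_sum_le _ _).trans (Finset.sum_le_sum fun j hj => ?_))
    have hpi : (0 : ℝ) < p i := by exact_mod_cast hp i hi
    have hqj : (0 : ℝ) < q j := by exact_mod_cast hq j hj
    rw [norm_mul, norm_mul, norm_coe_cpow (hp i hi), norm_coe_cpow (hq j hj), Complex.add_re,
      Complex.sub_re, hre]
    have h2 : (1 / 2 : ℂ).re = 1 / 2 := by simp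
    rw [h2]
    gcongr
    · rw [add_comm ((p i : ℝ) ^ _)]
      exact hmono hpi (by linarith) (by linarith)
    · exact hmono hqj (by linarith) (by linarith)
  · intro z hz
    rw [Set.mem_preimage, Set.mem_singleton_iff] at hz
    refine (norm_interpFun_of_re_eq_zero he hf hp hq (by rw [hre, hz, mul_zero])).trans ?_
    gcongr
  · intro z hz
    rw [Set.mem_preimage, Set.mem_singleton_iff] at hz
    refine (norm_interpFun_le hf hP hp hq _).trans ?_
    have h3 : 2 * (((α / 2 : ℝ) : ℂ) * z).re = α := by
      rw [hre, hz]
      ring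
    rw [h3]
    gcongr

end Interpolation

/-! ### Comparison of a projective measurement with the Petz-Rényi divergence -/

section Petz

variable {H : Type u} [NormedAddCommGroup H] [InnerProductSpace ℂ H] [CompleteSpace H]

theorem isStarProjection_eigenProj (T : H →L[ℂ] H) (p : ℝ≥0) : IsStarProjection (eigenProj T p) :=
  isStarProjection_starProjection

theorem eigenProj_apply_of_eigenvector {T : H →L[ℂ] H} {p : ℝ≥0} {x : H}
    (hx : T x = ((p : ℝ) : ℂ) • x) : eigenProj T p x = x := by
  refine Submodule.starProjection_eq_self_iff.2 (LinearMap.mem_ker.2 ?_)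
  simp [hx]

theorem mul_eigenProj (T : H →L[ℂ] H) (p : ℝ≥0) :
    T * eigenProj T p = ((p : ℝ) : ℂ) • eigenProj T p := by
  ext x
  have h : eigenProj T p x ∈ LinearMap.ker (T - ((p : ℝ) : ℂ) • (1 : H →L[ℂ] H)).toLinearMap :=
    Submodule.starProjection_apply_mem _ x
  have h2 : T (eigenProj T p x) - ((p : ℝ) : ℂ) • eigenProj T p x = 0 := h
  exact sub_eq_zero.1 h2

theorem hsNormSq_eigenProj_ne_top {T : H →L[ℂ] H} (hT : T ∈ posTraceClass H) {p : ℝ≥0}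
    (hp : p ≠ 0) : hsNormSq (eigenProj T p) ≠ ∞ := by
  have hE := isStarProjection_eigenProj T p
  have h := conj_proj_mem_traceClass (posTraceClass_subset hT) hE
  rw [mul_assoc, mul_eigenProj, mul_smul_comm, hE.isIdempotentElem.eq] at h
  have h2 := Submodule.smul_mem _ (((p : ℝ) : ℂ)⁻¹) h
  rw [smul_smul, inv_mul_cancel₀ (by exact_mod_cast hp), one_smul] at h2
  have h3 := summable_of_mem_traceClass h2
  have h4 : star (eigenProj T p) * eigenProj T p = eigenProj T p := by
    rw [hE.isSelfAdjoint.star_eq, hE.isIdempotentElem.eq]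
  rw [← h4] at h3
  simp_rw [inner_apply_star_mul_self] at h3
  exact tsum_enorm_sq_ne_top_iff.2 (Complex.summable_ofReal.1 h3)

theorem trace_mul_proj {E F : H →L[ℂ] H} (hE : IsStarProjection E) (hF : IsStarProjection F)
    (hfin : hsNormSq E ≠ ∞) : ENNReal.ofReal (trace (E * F)).re = hsNormSq (F * E) := by
  have h := trace_star_mul_comm hfin (hsNormSq_mul_ne_top' F hfin)
  have h2 := trace_star_mul_self (F * E)
  rw [star_mul, hE.isSelfAdjoint.star_eq, hF.isSelfAdjoint.star_eq, mul_assoc, ← mul_assoc F,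
    hF.isIdempotentElem.eq, ← mul_assoc] at h2
  rw [hE.isSelfAdjoint.star_eq, ← mul_assoc, hE.isIdempotentElem.eq, h2] at h
  rw [h, Complex.ofReal_re, ENNReal.ofReal_toReal (hsNormSq_mul_ne_top F hfin)]

variable {ι κ : Type*}

/-- The trace is the squared Hilbert-Schmidt norm of `F E`. In the two eigenbases, pairs with
eigenvalues `(x, y)` contribute exactly `|⟪e i, f j⟫|²`; the other pairs are only bounded below by
`0`. The condition `x ≠ 0` makes `E` Hilbert-Schmidt, while `y` may be `0`. -/
theorem tsum_le_trace_eigenProj_mul {T S : H →L[ℂ] H} (hT : T ∈ posTraceClass H)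
    (e : HilbertBasis ι ℂ H) (f : HilbertBasis κ ℂ H) {p : ι → ℝ≥0} {q : κ → ℝ≥0}
    (he : ∀ i, T (e i) = ((p i : ℝ) : ℂ) • e i) (hf : ∀ j, S (f j) = ((q j : ℝ) : ℂ) • f j)
    {x : ℝ≥0} (hx : x ≠ 0) (y : ℝ≥0) :
    ∑' ij : ι × κ, {ij : ι × κ | (p ij.1, q ij.2) = (x, y)}.indicator
      (fun ij => ‖⟪e ij.1, f ij.2⟫_ℂ‖ₑ ^ 2) ij ≤
        ENNReal.ofReal (trace (eigenProj T x * eigenProj S y)).re := by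
  classical
  have hF := isStarProjection_eigenProj S y
  rw [trace_mul_proj (isStarProjection_eigenProj T x) hF (hsNormSq_eigenProj_ne_top hT hx),
    hsNormSq_eq_tsum e, ENNReal.tsum_prod']
  refine ENNReal.tsum_le_tsum fun i => ?_
  rw [← tsum_enorm_inner_sq f]
  refine ENNReal.tsum_le_tsum fun j => ?_
  by_cases h : (p i, q j) = (x, y)
  · obtain ⟨rfl, rfl⟩ := Prod.mk.inj h
    have h1 := inner_star_left (eigenProj S (q j)) (f j) (eigenProj T (p i) (e i))
    rw [hF.isSelfAdjoint.star_eq, eigenProj_apply_of_eigenvector (hf j)] at h1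
    rw [Set.indicator_apply, if_pos (by exact h), mul_apply_eq_comp, ← h1, eigenProj_apply_of_eigenvector (he i),
      ← inner_conj_symm, RCLike.enorm_conj]
  · rw [Set.indicator_apply, if_neg (by exact h)]
    exact zero_le

theorem tsum_le_petz_tsum {α : ℝ} (hα : 1 < α) {T S : H →L[ℂ] H} (hT : T ∈ posTraceClass H)
    (e : HilbertBasis ι ℂ H) (f : HilbertBasis κ ℂ H) {p : ι → ℝ≥0} {q : κ → ℝ≥0}
    (he : ∀ i, T (e i) = ((p i : ℝ) : ℂ) • e i) (hf : ∀ j, S (f j) = ((q j : ℝ) : ℂ) • f j) :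
    ∑' ij : ι × κ, (p ij.1 : ℝ≥0∞) ^ α * (q ij.2 : ℝ≥0∞) ^ (1 - α) *
        ‖⟪e ij.1, f ij.2⟫_ℂ‖ₑ ^ 2 ≤
      ∑' (x : ℝ≥0) (y : ℝ≥0), (x : ℝ≥0∞) ^ α * (y : ℝ≥0∞) ^ (1 - α) *
        ENNReal.ofReal (trace (eigenProj T x * eigenProj S y)).re := by
  classical
  rw [← ENNReal.tsum_prod (f := fun x y : ℝ≥0 => (x : ℝ≥0∞) ^ α * (y : ℝ≥0∞) ^ (1 - α) *
    ENNReal.ofReal (trace (eigenProj T x * eigenProj S y)).re)]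
  have h1 : ∀ ij : ι × κ, (p ij.1 : ℝ≥0∞) ^ α * (q ij.2 : ℝ≥0∞) ^ (1 - α) *
        ‖⟪e ij.1, f ij.2⟫_ℂ‖ₑ ^ 2 =
      ∑' xy : ℝ≥0 × ℝ≥0, (xy.1 : ℝ≥0∞) ^ α * (xy.2 : ℝ≥0∞) ^ (1 - α) *
        {ij : ι × κ | (p ij.1, q ij.2) = xy}.indicator
          (fun ij => ‖⟪e ij.1, f ij.2⟫_ℂ‖ₑ ^ 2) ij := by
    intro ij
    rw [tsum_eq_single (p ij.1, q ij.2)]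
    · rw [Set.indicator_apply, if_pos (by rfl)]
    · intro xy hxy
      rw [Set.indicator_apply, if_neg (by exact fun h => hxy (Eq.symm h)), mul_zero]
  simp_rw [h1]
  rw [ENNReal.tsum_comm]
  refine ENNReal.tsum_le_tsum fun xy => ?_
  rw [ENNReal.tsum_mul_left]
  rcases eq_or_ne xy.1 0 with h0 | h0
  · rw [h0, ENNReal.coe_zero, ENNReal.zero_rpow_of_pos (by linarith), zero_mul, zero_mul, zero_mul]
  · gcongr
    exact tsum_le_trace_eigenProj_mul hT e f he hf h0 xy.2

omit [CompleteSpace H] in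
theorem interpFun_half {e : ι → H} {f : κ → H} {p : ι → ℝ≥0} {q : κ → ℝ≥0} {P : H →L[ℂ] H}
    {I : Finset ι} {J : Finset κ} : interpFun e f p q P I J (1 / 2) =
      ∑ i ∈ I, ((p i : ℝ) : ℂ) * ∑ j ∈ J, ⟪e i, f j⟫_ℂ * ⟪P (f j), P (e i)⟫_ℂ := by
  refine Finset.sum_congr rfl fun i _ => ?_
  rw [Finset.mul_sum]
  refine Finset.sum_congr rfl fun j hj => ?_
  rw [add_halves, sub_self, Complex.cpow_one, Complex.cpow_zero, mul_one]

/-- The exponents of `√a` add up to `1`, so one `√a` cancels; squaring gives the result. -/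
theorem le_of_le_sqrt_mul {a b c θ : ℝ} (ha : 0 ≤ a) (hb : 0 ≤ b) (hc : 0 ≤ c)
    (h : a ≤ (Real.sqrt a * Real.sqrt b) ^ (1 - θ) * (Real.sqrt a * Real.sqrt c) ^ θ) :
    a ≤ b ^ (1 - θ) * c ^ θ := by
  rcases ha.eq_or_lt with rfl | ha
  · positivity
  have hs : 0 < Real.sqrt a := Real.sqrt_pos.2 ha
  have h1 : (Real.sqrt a * Real.sqrt b) ^ (1 - θ) * (Real.sqrt a * Real.sqrt c) ^ θ =
      Real.sqrt a * (Real.sqrt b ^ (1 - θ) * Real.sqrt c ^ θ) := by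
    rw [Real.mul_rpow hs.le (Real.sqrt_nonneg _), Real.mul_rpow hs.le (Real.sqrt_nonneg _)]
    have : Real.sqrt a ^ (1 - θ) * Real.sqrt a ^ θ = Real.sqrt a := by
      rw [← Real.rpow_add hs, sub_add_cancel, Real.rpow_one]
    calc _ = (Real.sqrt a ^ (1 - θ) * Real.sqrt a ^ θ) *
        (Real.sqrt b ^ (1 - θ) * Real.sqrt c ^ θ) := by ring
      _ = _ := by rw [this]
  rw [h1] at h
  have h2 : Real.sqrt a ≤ Real.sqrt b ^ (1 - θ) * Real.sqrt c ^ θ := by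
    refine le_of_mul_le_mul_left ?_ hs
    rwa [Real.mul_self_sqrt ha.le]
  have hsq : ∀ {x : ℝ} (t : ℝ), 0 ≤ x → (Real.sqrt x ^ t) ^ 2 = x ^ t := fun {x} t hx => by
    rw [← Real.rpow_natCast, ← Real.rpow_mul (Real.sqrt_nonneg _), mul_comm,
      Real.rpow_mul (Real.sqrt_nonneg _), Real.rpow_natCast, Real.sq_sqrt hx]
  calc a = Real.sqrt a ^ 2 := (Real.sq_sqrt ha.le).symm
    _ ≤ (Real.sqrt b ^ (1 - θ) * Real.sqrt c ^ θ) ^ 2 := by gcongr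
    _ = _ := by rw [mul_pow, hsq _ hb, hsq _ hc]

/-- Hölder's inequality for the Petz-Rényi divergence and a projective measurement. -/
theorem trace_conj_le_interp {α : ℝ} (hα : 1 < α) {T S P : H →L[ℂ] H} (hT : T ∈ posTraceClass H)
    (hS : S ∈ posTraceClass H) (hP : IsStarProjection P) (e : HilbertBasis ι ℂ H)
    (f : HilbertBasis κ ℂ H) {p : ι → ℝ≥0} {q : κ → ℝ≥0}
    (he : ∀ i, T (e i) = ((p i : ℝ) : ℂ) • e i) (hf : ∀ j, S (f j) = ((q j : ℝ) : ℂ) • f j)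
    (hfin : ∑' ij : ι × κ, (p ij.1 : ℝ≥0∞) ^ α * (q ij.2 : ℝ≥0∞) ^ (1 - α) *
        ‖⟪e ij.1, f ij.2⟫_ℂ‖ₑ ^ 2 ≠ ∞) :
    (trace (P * T * P)).re ≤ (trace (P * S * P)).re ^ (1 - 1 / α) *
      (∑' ij : ι × κ, (p ij.1 : ℝ≥0∞) ^ α * (q ij.2 : ℝ≥0∞) ^ (1 - α) *
        ‖⟪e ij.1, f ij.2⟫_ℂ‖ₑ ^ 2).toReal ^ (1 / α) := by
  classical
  set c := ∑' ij : ι × κ, (p ij.1 : ℝ≥0∞) ^ α * (q ij.2 : ℝ≥0∞) ^ (1 - α) *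
        ‖⟪e ij.1, f ij.2⟫_ℂ‖ₑ ^ 2 with hc
  have hsT := hasSum_trace_conj_eigenbasis hT hP e he
  have hsS := hasSum_trace_conj_eigenbasis hS hP f hf
  -- Such a pair would contribute `∞` to the finite sum. Hence discarding the indices with `q j =
  -- 0`, where complex powers are not usable, loses nothing.
  have hzero : ∀ i j, 0 < p i → q j = 0 → ⟪e i, f j⟫_ℂ = 0 := by
    intro i j hi hj
    by_contra hne
    have h1 := ENNReal.ne_top_of_tsum_ne_top hfin (i, j)
    refine h1 ?_
    rw [hj, ENNReal.coe_zero, ENNReal.zero_rpow_of_neg (by linarith), ENNReal.mul_top,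
      ENNReal.top_mul]
    · simpa using hne
    · exact (ENNReal.rpow_pos (by exact_mod_cast hi) ENNReal.coe_ne_top).ne'
  have hcsum : ∀ (I : Finset ι) (J : Finset κ), (∀ i ∈ I, 0 < p i) → (∀ j ∈ J, 0 < q j) →
      ∑ i ∈ I, ∑ j ∈ J, (p i : ℝ) ^ α * (q j : ℝ) ^ (1 - α) * ‖⟪e i, f j⟫_ℂ‖ ^ 2 ≤ c.toReal := by
    intro I J hI hJ
    have h1 := ENNReal.toReal_mono hfin (ENNReal.sum_le_tsum (f := fun ij : ι × κ =>
      (p ij.1 : ℝ≥0∞) ^ α * (q ij.2 : ℝ≥0∞) ^ (1 - α) * ‖⟪e ij.1, f ij.2⟫_ℂ‖ₑ ^ 2) (I ×ˢ J))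
    rw [ENNReal.toReal_sum fun ij _ => ENNReal.ne_top_of_tsum_ne_top hfin ij,
      Finset.sum_product] at h1
    simpa [← ENNReal.toReal_rpow] using h1
  have key : ∀ I : Finset ι, (∀ i ∈ I, 0 < p i) → ∑ i ∈ I, (p i : ℝ) * ‖P (e i)‖ ^ 2 ≤
      (trace (P * S * P)).re ^ (1 - 1 / α) * c.toReal ^ (1 / α) := by
    intro I hI
    have ha0 : 0 ≤ ∑ i ∈ I, (p i : ℝ) * ‖P (e i)‖ ^ 2 :=
      Finset.sum_nonneg fun i _ => by positivity
    refine le_of_le_sqrt_mul ha0 (trace_re_nonneg (conj_proj_nonneg hS.1 hP))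
      ENNReal.toReal_nonneg ?_
    -- With `I` fixed, letting `J` grow turns the value at `z = 1/2` into the same sum over `I` that
    -- occurs as `a` in the interpolation bound, which is what permits cancelling `√a`. The limit in
    -- `I` is taken only afterwards.
    have hlim : Filter.Tendsto (fun J : Finset κ =>
        ‖∑ i ∈ I, ((p i : ℝ) : ℂ) * ∑ j ∈ J, ⟪e i, f j⟫_ℂ * ⟪P (f j), P (e i)⟫_ℂ‖)
        Filter.atTop (nhds (∑ i ∈ I, (p i : ℝ) * ‖P (e i)‖ ^ 2)) := by
      have h1 : ∀ i, Filter.Tendsto (fun J : Finset κ =>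
          ∑ j ∈ J, ⟪e i, f j⟫_ℂ * ⟪P (f j), P (e i)⟫_ℂ) Filter.atTop
          (nhds ((‖P (e i)‖ ^ 2 : ℝ) : ℂ)) := by
        intro i
        have h2 := f.hasSum_inner_mul_inner (e i) (P (P (e i)))
        have h3 : ⟪e i, P (P (e i))⟫_ℂ = ((‖P (e i)‖ ^ 2 : ℝ) : ℂ) := by
          rw [← inner_apply_star_mul_self, hP.isSelfAdjoint.star_eq, mul_apply_eq_comp]
        rw [h3] at h2
        refine h2.congr_fun fun j => ?_
        rw [← inner_star_right, hP.isSelfAdjoint.star_eq]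
      have h4 := (tendsto_finsetSum I fun i _ => (h1 i).const_mul ((p i : ℝ) : ℂ)).norm
      convert h4 using 2
      rw [← Real.norm_of_nonneg ha0, ← Complex.norm_real]
      congr 1
      push_cast
      rfl
    refine le_of_tendsto' hlim fun J => ?_
    have hJ : ∀ j ∈ J.filter (fun j => 0 < q j), 0 < q j := fun j hj => (Finset.mem_filter.1 hj).2
    have h5 : ∑ i ∈ I, ((p i : ℝ) : ℂ) * ∑ j ∈ J, ⟪e i, f j⟫_ℂ * ⟪P (f j), P (e i)⟫_ℂ =
        interpFun e f p q P I (J.filter (fun j => 0 < q j)) (1 / 2) := by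
      rw [interpFun_half]
      refine Finset.sum_congr rfl fun i hi => ?_
      rw [Finset.sum_filter_of_ne]
      intro j _ hj
      by_contra hq
      exact hj (by rw [hzero i j (hI i hi) (nonpos_iff_eq_zero.1 (not_lt.1 hq)), zero_mul])
    rw [h5]
    exact norm_interpFun_half_le e.orthonormal f.orthonormal hP hI hJ hα le_rfl
      (sum_le_hasSum _ (fun j _ => by positivity) hsS) (hcsum I _ hI hJ)
  refine le_of_tendsto' hsT fun I => ?_
  rw [← Finset.sum_filter_of_ne (p := fun i => 0 < p i)]
  · exact key _ fun i hi => (Finset.mem_filter.1 hi).2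
  · intro i _ hi
    exact pos_iff_ne_zero.2 fun h => hi (by rw [h, NNReal.coe_zero, zero_mul])

theorem measured_le_petzRenyi {α : ℝ} (hα : 1 < α) (ρ σ : DensityOperator H) {P : H →L[ℂ] H}
    (hP : IsStarProjection P) :
    ((1 / (α - 1) : ℝ) : EReal) * log2 (ENNReal.ofReal (trace (P * ρ.op * P)).re ^ α *
      ENNReal.ofReal (trace (P * σ.op * P)).re ^ (1 - α)) ≤ petzRenyi α ρ σ := by
  have hα1 : 0 < α - 1 := by linarith
  have hα0 : 0 < α := by linarith
  refine mul_le_mul_of_nonneg_left (log2_mono ?_)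
    (by exact_mod_cast (by positivity : (0 : ℝ) ≤ 1 / (α - 1)))
  obtain ⟨ι, e, p, he⟩ := exists_eigenbasis ρ.mem_posTraceClass
  obtain ⟨κ, f, q, hf⟩ := exists_eigenbasis σ.mem_posTraceClass
  refine le_trans ?_ (tsum_le_petz_tsum hα ρ.mem_posTraceClass e f he hf)
  by_cases hfin : ∑' ij : ι × κ, (p ij.1 : ℝ≥0∞) ^ α * (q ij.2 : ℝ≥0∞) ^ (1 - α) *
        ‖⟪e ij.1, f ij.2⟫_ℂ‖ₑ ^ 2 = ∞
  · rw [hfin]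
    exact le_top
  have h := trace_conj_le_interp hα ρ.mem_posTraceClass σ.mem_posTraceClass hP e f he hf hfin
  set c := ∑' ij : ι × κ, (p ij.1 : ℝ≥0∞) ^ α * (q ij.2 : ℝ≥0∞) ^ (1 - α) *
        ‖⟪e ij.1, f ij.2⟫_ℂ‖ₑ ^ 2
  have ha0 := trace_re_nonneg (conj_proj_nonneg ρ.nonneg hP)
  have hb0 := trace_re_nonneg (conj_proj_nonneg σ.nonneg hP)
  set a := (trace (P * ρ.op * P)).re
  set b := (trace (P * σ.op * P)).re
  rcases ha0.eq_or_lt with ha | ha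
  · rw [← ha, ENNReal.ofReal_zero, ENNReal.zero_rpow_of_pos hα0, zero_mul]
    exact zero_le
  have hθ : 0 < 1 - 1 / α := by
    rw [sub_pos, div_lt_one hα0]
    exact hα
  -- If `b = 0 < a`, the left side would be infinite; the interpolation bound excludes this case, as
  -- it would give `a ≤ 0`.
  rcases hb0.eq_or_lt with hb | hb
  · rw [← hb, Real.zero_rpow hθ.ne', zero_mul] at h
    exact absurd h (not_le.2 ha)
  rw [ENNReal.ofReal_rpow_of_pos ha, ENNReal.ofReal_rpow_of_pos hb,
    ← ENNReal.ofReal_mul (by positivity)]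
  refine ENNReal.ofReal_le_of_le_toReal ?_
  have hc0 : 0 ≤ c.toReal := ENNReal.toReal_nonneg
  calc a ^ α * b ^ (1 - α) ≤ (b ^ (1 - 1 / α) * c.toReal ^ (1 / α)) ^ α * b ^ (1 - α) := by gcongr
    _ = b ^ (α - 1) * b ^ (1 - α) * c.toReal := by
      rw [Real.mul_rpow (by positivity) (by positivity), ← Real.rpow_mul hb.le,
        ← Real.rpow_mul hc0]
      have h1 : (1 - 1 / α) * α = α - 1 := by field_simp
      have h2 : 1 / α * α = 1 := by field_simp
      rw [h1, h2, Real.rpow_one]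
      ring
    _ = c.toReal := by
      rw [← Real.rpow_add hb]
      simp

end Petz

end QInfo

end

theorem mainTheorem6 {H : Type u} [NormedAddCommGroup H] [InnerProductSpace ℂ H] [CompleteSpace H]
    [TopologicalSpace.SeparableSpace H] (ρ σ : QInfo.DensityOperator H) :
    (∀ l : ℝ, (l : EReal) ≤ QInfo.dMax ρ σ →
      ∀ ε : ℝ, ε = (QInfo.trace (QInfo.excess l ρ σ)).re →
        QInfo.dMaxSmooth (Real.sqrt ε) ρ σ ≤
          (l : EReal) - QInfo.log2 (ENNReal.ofReal (1 - ε))) ∧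
    (∀ ε : ℝ, 0 < ε → ε < 1 →
      QInfo.dMaxSmooth ε ρ σ ≤
        QInfo.dHyp (1 - ε ^ 2) ρ σ - ((Real.logb 2 (1 - ε ^ 2) : ℝ) : EReal)) ∧
    (∀ ε : ℝ, 0 < ε → ε < 1 → ∀ α : ℝ, 1 < α →
      ∀ D : QInfo.StateDivergence.{u}, QInfo.IsQuantumRenyiDivergence α D →
        QInfo.dMaxSmooth ε ρ σ ≤
          D H ρ σ + ((2 / (α - 1) * Real.logb 2 (1 / ε) : ℝ) : EReal) +
            ((Real.logb 2 (1 / (1 - ε ^ 2)) : ℝ) : EReal)) ∧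
    (∀ ε : ℝ, 0 < ε → ε < 1 → ∀ α : ℝ, 1 < α →
        QInfo.dMaxSmooth ε ρ σ ≤
          QInfo.petzRenyi α ρ σ + ((2 / (α - 1) * Real.logb 2 (1 / ε) : ℝ) : EReal) +
            ((Real.logb 2 (1 / (1 - ε ^ 2)) : ℝ) : EReal)) :=
  ⟨fun _ _ _ hε => QInfo.dMaxSmooth_le_of_excess ρ σ hε,
    fun _ h0 h1 => QInfo.dMaxSmooth_le_dHyp h0 h1 ρ σ,
    fun _ h0 h1 _ hα _ hD => QInfo.dMaxSmooth_le_of_measured h0 h1 hα ρ σ _ fun _ hP =>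
      QInfo.measured_le_of_isQuantumRenyiDivergence hα hD ρ σ hP,
    fun _ h0 h1 _ hα => QInfo.dMaxSmooth_le_of_measured h0 h1 hα ρ σ _ fun _ hP =>
      QInfo.measured_le_petzRenyi hα ρ σ hP⟩
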